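/- Let $\mu$ be the Haar probability measure on $\mathrm{SO}(3)$, let $\mathcal X=L^2(\mathrm{SO}(3),\mathbb C)$ with inner product $\langle x,y\rangle=\int x\,\bar y\,d\mu$, and let $(\ell_A y)(B)=y(A^{-1}B)$ for $A,B\in\mathrm{SO}(3)$. For $x,\psi\in\mathcal X$ define the left covariance (convolution) $x*_\ell\psi:\mathrm{SO}(3)\to\mathbb C$ by $(x*_\ell\psi)(A)=\langle x,\ell_A\psi\rangle$. Let $Z(\theta)$ and $Y(\theta)$ be the rotations by the angle $\theta$ around the $z$-axis and the $y$-axis. For $l=0,1,2,\dots$ the Wigner D-matrix $D^l=(D^l_{m,n})_{-l\le m,n\le l}$ is the function on $\mathrm{SO}(3)$ given in Euler angles by $$D^l_{m,n}\big(Z(\alpha)Y(\beta)Z(\gamma)\big)=e^{-im\alpha}\,d^l_{m,n}(\beta)\,e^{-in\gamma},\qquad d^l(\beta)=\exp\!\Big(\tfrac{\beta}{2}\big(Q^l-(Q^l)^{\top}\big)\Big),\quad 0\le\beta\le\pi,$$ where $Q^l$ has the entries $Q^l_{m,m+1}=\sqrt{(l-m)(l+m+1)}$ and is zero elsewhere.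 Let $I$ be the set of triples $(l,m,n)$ with $l\ge 0$ and $-l\le m,n\le l$. A family $(\hat x^l_{m,n})_{I}$ of complex numbers is the family of Fourier coefficients of $x\in\mathcal X$ if $$x=\sum_{(l,m,n)\in I}\hat x^l_{-m,-n}\,D^l_{m,n}$$ with unconditional convergence in $\mathcal X$. Then every $x\in\mathcal X$ has exactly one family of Fourier coefficients, and for all $x,\psi\in\mathcal X$ with Fourier coefficients $(\hat x^l_{m,n})$ and $(\hat\psi^l_{m,n})$ the function $x*_\ell\psi$ belongs to $\mathcal X$ and has the Fourier coefficients $$\widehat{(x*_\ell\psi)}{}^{\,l}_{m,n}=\frac{1}{2l+1}\sum_{s=-l}^{l}\hat x^l_{m,s}\,\overline{\hat\psi^l_{n,s}},\qquad (l,m,n)\in I.$$ -/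

import Mathlib

open MeasureTheory

noncomputable section

namespace SO3Fourier

/-- The group `SO(3)` of real orthogonal `3 × 3` matrices of determinant one. -/
abbrev SO3 : Type := ↥(Matrix.specialOrthogonalGroup (Fin 3) ℝ)

theorem transpose_mul_self (A : SO3) : (A : Matrix (Fin 3) (Fin 3) ℝ).transpose * A.1 = 1 :=
  (Matrix.mem_orthogonalGroup_iff' (Fin 3) ℝ).1 A.2.1

theorem mul_transpose_self (A : SO3) : (A : Matrix (Fin 3) (Fin 3) ℝ) * A.1.transpose = 1 :=
  (Matrix.mem_orthogonalGroup_iff (Fin 3) ℝ).1 A.2.1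

theorem det_eq_one (A : SO3) : (A : Matrix (Fin 3) (Fin 3) ℝ).det = 1 := A.2.2

theorem coe_inv (A : SO3) : ((A⁻¹ : SO3) : Matrix (Fin 3) (Fin 3) ℝ) = A.1.transpose := rfl

instance : IsTopologicalGroup SO3 where
  continuous_mul := by
    refine Continuous.subtype_mk ?_ _
    exact (continuous_subtype_val.comp continuous_fst).matrix_mul
      (continuous_subtype_val.comp continuous_snd)
  continuous_inv := by
    refine continuous_induced_rng.2 ?_
    exact continuous_subtype_val.matrix_transpose

theorem abs_entry_le_one (A : SO3) (i j : Fin 3) : |A.1 i j| ≤ 1 := by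
  have h := congrFun (congrFun (mul_transpose_self A) i) i
  simp only [Matrix.mul_apply, Matrix.transpose_apply, Fin.sum_univ_three, Matrix.one_apply_eq] at h
  rw [abs_le_one_iff_mul_self_le_one]
  fin_cases j <;> simp <;>
    nlinarith [mul_self_nonneg (A.1 i 0), mul_self_nonneg (A.1 i 1), mul_self_nonneg (A.1 i 2)]

instance : CompactSpace SO3 := by
  have hK : IsCompact (Set.pi Set.univ (fun _ : Fin 3 => Set.pi Set.univ
      (fun _ : Fin 3 => Set.Icc (-1 : ℝ) 1))) :=
    isCompact_univ_pi fun _ => isCompact_univ_pi fun _ => isCompact_Icc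
  have hc : IsClosed {A : Matrix (Fin 3) (Fin 3) ℝ | A * A.transpose = 1 ∧ A.det = 1} :=
    (isClosed_eq (continuous_id.matrix_mul continuous_id.matrix_transpose) continuous_const).inter
      (isClosed_eq continuous_id.matrix_det continuous_const)
  have he : ((Matrix.specialOrthogonalGroup (Fin 3) ℝ : Submonoid (Matrix (Fin 3) (Fin 3) ℝ)) :
      Set (Matrix (Fin 3) (Fin 3) ℝ)) = {A | A * A.transpose = 1 ∧ A.det = 1} := by
    ext A
    exact Matrix.mem_specialOrthogonalGroup_iff.trans
      (and_congr (Matrix.mem_orthogonalGroup_iff (Fin 3) ℝ) Iff.rfl)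
  refine isCompact_iff_compactSpace.1 (hK.of_isClosed_subset (he ▸ hc) ?_)
  intro A hA i _ j _
  exact abs_le.1 (abs_entry_le_one ⟨A, hA⟩ i j)

instance : SecondCountableTopology SO3 :=
  inferInstanceAs (SecondCountableTopology
    {A : Fin 3 → Fin 3 → ℝ // A ∈ Matrix.specialOrthogonalGroup (Fin 3) ℝ})

instance : MeasurableSpace SO3 := borel SO3

instance : BorelSpace SO3 := ⟨rfl⟩

/-- The Haar measure of `SO(3)` of total mass one. -/
def haar : Measure SO3 := Measure.haarMeasure ⊤

instance : Measure.IsHaarMeasure haar := Measure.isHaarMeasure_haarMeasure _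

instance : IsProbabilityMeasure haar := ⟨Measure.haarMeasure_self⟩

/-- The space `L²(SO(3), ℂ)`. -/
abbrev L2SO3 : Type := Lp ℂ 2 haar

/-- The left action `(ℓ_A y)(B) = y(A⁻¹ B)` on `L²(SO(3), ℂ)`. -/
def leftAction (A : SO3) (y : L2SO3) : L2SO3 :=
  Lp.compMeasurePreserving (fun B : SO3 => A⁻¹ * B) (measurePreserving_mul_left haar A⁻¹) y

/-- The left covariance `(x *_ℓ ψ)(A) = ⟨x, ℓ_A ψ⟩ = ∫ x(B) conj (ψ(A⁻¹ B)) dμ(B)`. The inner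
product of Mathlib is conjugate-linear in its first argument. -/
def leftCovariance (x ψ : L2SO3) (A : SO3) : ℂ := inner ℂ (leftAction A ψ) x

/-- The rotation by the angle `θ` around the `z`-axis. -/
def rotZ (θ : ℝ) : Matrix (Fin 3) (Fin 3) ℝ :=
  !![Real.cos θ, -Real.sin θ, 0; Real.sin θ, Real.cos θ, 0; 0, 0, 1]

/-- The rotation by the angle `θ` around the `y`-axis. -/
def rotY (θ : ℝ) : Matrix (Fin 3) (Fin 3) ℝ :=
  !![Real.cos θ, 0, Real.sin θ; 0, 1, 0; -Real.sin θ, 0, Real.cos θ]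

/-- Euler angle `α` in `A = Z(α) Y(β) Z(γ)`; it is `0` if `β` is `0` or `π`. -/
def eulerAlpha (A : SO3) : ℝ := Complex.arg ⟨A.1 0 2, A.1 1 2⟩

/-- Euler angle `β ∈ [0, π]` in `A = Z(α) Y(β) Z(γ)`. -/
def eulerBeta (A : SO3) : ℝ := Real.arccos (A.1 2 2)

/-- Euler angle `γ` in `A = Z(α) Y(β) Z(γ)`. -/
def eulerGamma (A : SO3) : ℝ :=
  if A.1 2 2 ^ 2 = 1 then Complex.arg ⟨A.1 1 1, A.1 1 0⟩ else Complex.arg ⟨-A.1 2 0, A.1 2 1⟩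

/-- The index set `{-l, …, l}` of the rows and columns of `D^l`. -/
abbrev Idx (l : ℕ) : Type := {m : ℤ // m ∈ Finset.Icc (-(l : ℤ)) l}

instance (l : ℕ) : Neg (Idx l) :=
  ⟨fun m => ⟨-m.1, by have := Finset.mem_Icc.1 m.2; exact Finset.mem_Icc.2 (by omega)⟩⟩

/-- The matrix `Q^l` with entries `√((l - m)(l + m + 1))` at `(m, m + 1)` and `0` elsewhere. -/
def ladder (l : ℕ) : Matrix (Idx l) (Idx l) ℝ :=
  Matrix.of fun m n => if m.1 + 1 = n.1 then √(((l : ℝ) - m.1) * ((l : ℝ) + m.1 + 1)) else 0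

/-- The real orthogonal matrix `d^l(β) = exp((β / 2) (Q^l - (Q^l)ᵀ))`, with the matrix
exponential. -/
def wignerSmallD (l : ℕ) (β : ℝ) : Matrix (Idx l) (Idx l) ℝ :=
  NormedSpace.exp ((β / 2) • (ladder l - (ladder l).transpose))

/-- The Wigner D-matrix `D^l(Z(α) Y(β) Z(γ)) = exp(-iαΛ) d^l(β) exp(-iγΛ)`, where `Λ` is the
diagonal matrix with entries `-l, …, l`. -/
def wignerD (l : ℕ) (A : SO3) : Matrix (Idx l) (Idx l) ℂ :=
  Matrix.of fun m n =>
    Complex.exp (-Complex.I * m.1 * eulerAlpha A) * (wignerSmallD l (eulerBeta A) m n : ℂ) *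
      Complex.exp (-Complex.I * n.1 * eulerGamma A)

theorem cos_sin_arg {a b r : ℝ} (hr : 0 < r) (h : a ^ 2 + b ^ 2 = r ^ 2) :
    Real.cos (Complex.arg ⟨a, b⟩) = a / r ∧ Real.sin (Complex.arg ⟨a, b⟩) = b / r := by
  have hn : ‖(⟨a, b⟩ : ℂ)‖ = r := by
    rw [Complex.norm_def, Complex.normSq_mk, ← Real.sqrt_sq hr.le, ← h]
    ring_nf
  have h0 : (⟨a, b⟩ : ℂ) ≠ 0 := by
    rw [← norm_pos_iff, hn]; exact hr
  exact ⟨by rw [Complex.cos_arg h0, hn], by rw [Complex.sin_arg, hn]⟩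

/-- The angles chosen above are Euler angles of `A`. -/
theorem euler_decomposition (A : SO3) :
    (A : Matrix (Fin 3) (Fin 3) ℝ) =
      rotZ (eulerAlpha A) * rotY (eulerBeta A) * rotZ (eulerGamma A) := by
  have hadj : (A.1).adjugate = A.1.transpose := by
    have h := congrArg (· * A.1.transpose) (Matrix.adjugate_mul A.1)
    simpa [Matrix.mul_assoc, mul_transpose_self, det_eq_one] using h
  have hr := congrFun (congrFun (mul_transpose_self A) 2) 2
  have hc := congrFun (congrFun (transpose_mul_self A) 2) 2
  have hr1 := congrFun (congrFun (mul_transpose_self A) 1) 1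
  have hb : |A.1 2 2| ≤ 1 := abs_entry_le_one A 2 2
  have hcos : Real.cos (eulerBeta A) = A.1 2 2 :=
    Real.cos_arccos (abs_le.1 hb).1 (abs_le.1 hb).2
  have hsin : Real.sin (eulerBeta A) = √(1 - A.1 2 2 ^ 2) := Real.sin_arccos _
  have a00 := congrFun (congrFun hadj 0) 0
  have a01 := congrFun (congrFun hadj 1) 0
  have a10 := congrFun (congrFun hadj 0) 1
  have a11 := congrFun (congrFun hadj 1) 1
  simp only [Matrix.mul_apply, Matrix.transpose_apply, Fin.sum_univ_three,
    Matrix.one_apply_eq] at hr hc hr1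
  simp [Matrix.adjugate_fin_three] at a00 a01 a10 a11
  have main : ∀ ca sa cg sg sb : ℝ,
      A.1 0 0 = ca * A.1 2 2 * cg - sa * sg → A.1 0 1 = -(ca * A.1 2 2 * sg) - sa * cg →
      A.1 0 2 = ca * sb → A.1 1 0 = sa * A.1 2 2 * cg + ca * sg →
      A.1 1 1 = -(sa * A.1 2 2 * sg) + ca * cg → A.1 1 2 = sa * sb →
      A.1 2 0 = -(sb * cg) → A.1 2 1 = sb * sg →
      A.1 = !![ca, -sa, 0; sa, ca, 0; 0, 0, 1] * !![A.1 2 2, 0, sb; 0, 1, 0; -sb, 0, A.1 2 2] *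
        !![cg, -sg, 0; sg, cg, 0; 0, 0, 1] := by
    intros
    ext i j
    fin_cases i <;> fin_cases j <;> simp [Matrix.mul_apply, Fin.sum_univ_three] <;> linarith
  rw [rotZ, rotZ, rotY, hcos]
  by_cases hd : A.1 2 2 ^ 2 = 1
  · have hs : Real.sin (eulerBeta A) = 0 := by rw [hsin, hd]; simp
    obtain ⟨h02, h12⟩ : A.1 0 2 = 0 ∧ A.1 1 2 = 0 :=
      mul_self_add_mul_self_eq_zero.1 (by linarith only [hc, hd])
    obtain ⟨h20, h21⟩ : A.1 2 0 = 0 ∧ A.1 2 1 = 0 :=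
      mul_self_add_mul_self_eq_zero.1 (by linarith only [hr, hd])
    obtain ⟨k1, k2⟩ := cos_sin_arg (a := A.1 1 1) (b := A.1 1 0) one_pos
      (by rw [h12] at hr1; linarith)
    have e0 : eulerAlpha A = 0 := by
      rw [eulerAlpha, h02, h12]; exact Complex.arg_zero
    simp only [h12, h20, h21, h02] at a00 a01 a10 a11
    rw [eulerGamma, if_pos hd, e0, k1, k2, hs, Real.cos_zero, Real.sin_zero]
    apply main <;> (try simp only [h12, h20, h21, h02]) <;> linarith
  · have hlt : 0 < 1 - A.1 2 2 ^ 2 :=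
      sub_pos.2 (lt_of_le_of_ne ((sq_le_one_iff_abs_le_one _).2 hb) hd)
    have hs : 0 < Real.sin (eulerBeta A) := hsin ▸ Real.sqrt_pos.2 hlt
    have hs2 : Real.sin (eulerBeta A) ^ 2 = 1 - A.1 2 2 ^ 2 := by rw [hsin, Real.sq_sqrt hlt.le]
    obtain ⟨k1, k2⟩ := cos_sin_arg (a := A.1 0 2) (b := A.1 1 2) hs (by linarith)
    obtain ⟨k3, k4⟩ := cos_sin_arg (a := -A.1 2 0) (b := A.1 2 1) hs (by linarith)
    rw [eulerAlpha, eulerGamma, if_neg hd, k1, k2, k3, k4]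
    generalize Real.sin (eulerBeta A) = sb at *
    apply main <;> field_simp <;> try rw [hs2]
    · linear_combination -A.1 2 2 * a11 - a00
    · linear_combination A.1 2 2 * a10 - a01
    · linear_combination A.1 2 2 * a01 - a10
    · linear_combination -A.1 2 2 * a00 - a11

theorem measurable_entry (i j : Fin 3) : Measurable fun A : SO3 => A.1 i j :=
  (continuous_subtype_val.matrix_elem i j).measurable

theorem measurable_eulerAlpha : Measurable eulerAlpha :=
  Complex.measurable_arg.comp (Complex.measurableEquivRealProd.symm.measurable.comp
    ((measurable_entry 0 2).prodMk (measurable_entry 1 2)))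

theorem measurable_eulerBeta : Measurable eulerBeta :=
  Real.continuous_arccos.measurable.comp (measurable_entry 2 2)

theorem measurable_eulerGamma : Measurable eulerGamma :=
  Measurable.ite (measurableSet_eq_fun ((measurable_entry 2 2).pow_const 2) measurable_const)
    (Complex.measurable_arg.comp (Complex.measurableEquivRealProd.symm.measurable.comp
      ((measurable_entry 1 1).prodMk (measurable_entry 1 0))))
    (Complex.measurable_arg.comp (Complex.measurableEquivRealProd.symm.measurable.comp
      ((measurable_entry 2 0).neg.prodMk (measurable_entry 2 1))))

section
attribute [local instance] Matrix.linftyOpNormedRing Matrix.linftyOpNormedAlgebra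

theorem continuous_wignerSmallD (l : ℕ) (m n : Idx l) :
    Continuous fun β => wignerSmallD l β m n := by
  have h : Continuous (wignerSmallD l) :=
    (NormedSpace.exp_continuous (𝔸 := Matrix (Idx l) (Idx l) ℝ)).comp (by fun_prop)
  exact h.matrix_elem m n

end

theorem memLp_wignerD (l : ℕ) (m n : Idx l) : MemLp (fun A => wignerD l A m n) 2 haar := by
  obtain ⟨C, hC⟩ := (isCompact_Icc (a := (0 : ℝ)) (b := Real.pi)).exists_bound_of_continuousOn
    (continuous_wignerSmallD l m n).continuousOn
  refine MemLp.of_bound (Measurable.aestronglyMeasurable ?_) C (Filter.Eventually.of_forall ?_)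
  · have h1 := measurable_eulerAlpha
    have h2 := measurable_eulerGamma
    have h3 := (continuous_wignerSmallD l m n).measurable.comp measurable_eulerBeta
    have h3' : Measurable fun A : SO3 => (wignerSmallD l (eulerBeta A) m n : ℂ) :=
      Complex.measurable_ofReal.comp h3
    simp only [wignerD, Matrix.of_apply]
    fun_prop
  · intro A
    have e : ∀ (k : ℤ) (t : ℝ), ‖Complex.exp (-Complex.I * k * t)‖ = 1 := by
      intro k t
      simp [Complex.norm_exp]
    simp only [wignerD, Matrix.of_apply, norm_mul, e, one_mul, mul_one, Complex.norm_real]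
    exact hC _ ⟨Real.arccos_nonneg _, Real.arccos_le_pi _⟩

/-- The coefficient function `D^l_{m,n}` as an element of `L²(SO(3), ℂ)`. -/
def wignerL2 (l : ℕ) (m n : Idx l) : L2SO3 := (memLp_wignerD l m n).toLp

/-- Families `(c^l_{m,n})` of complex numbers with `l = 0, 1, 2, …` and `-l ≤ m, n ≤ l`. -/
abbrev CoeffFamily : Type := (l : ℕ) → Idx l → Idx l → ℂ

/-- `c` is a family of Fourier coefficients of `x`: with unconditional convergence in
`L²(SO(3), ℂ)`, `x` is the sum of `c^l_{-m,-n} D^l_{m,n}` over all `l` and `-l ≤ m, n ≤ l`. -/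
def HasFourierCoeffs (x : L2SO3) (c : CoeffFamily) : Prop :=
  HasSum (fun i : (l : ℕ) × (Idx l × Idx l) => c i.1 (-i.2.1) (-i.2.2) • wignerL2 i.1 i.2.1 i.2.2) x

end SO3Fourier

end

/-!
On the forms of degree `2l` in two variables the lift `U ∈ SU(2)` of a rotation `A` acts, in the
basis of the normalized monomials, by `D^l(A)`: both the Euler angle formula for `D^l` and this
action are products of exponentials of the same generators. Since `U` is determined by `A` up to a
sign, which forms of even degree do not see, `D^l` is a unitary representation of `SO(3)`. An
intertwiner of `D^l` and `D^l'` commutes with the generators, hence with the Casimir operator, so it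
vanishes for `l ≠ l'` and is a scalar for `l = l'`: the Schur orthogonality relations hold.

The powers `(v U w) ^ (2l)` span the same functions of `A` as the entries of `D^l`. By polarization
and `det U = 1` the span of the even powers is stable under products, and it contains the matrix
entries of `A`, which are quadratic in `U`. So it contains the polynomials in these entries, and the
Stone–Weierstrass theorem shows that the entries of all `D^l` are an orthogonal basis.

The left covariance is continuous and linear in `x`, so its coefficients need only be computed when
`x` is an entry of `D^l`, where `D^l(A B) = D^l(A) D^l(B)` expands the translates.
-/

noncomputable section

namespace SO3Fourier

open Matrix

/-! ### Unitary representations of compact groups -/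

section MatrixExp

variable {ι κ : Type*} [Fintype ι] [DecidableEq ι] [Fintype κ] [DecidableEq κ]

theorem hasDerivAt_matrix_exp_smul_apply (M : Matrix ι ι ℂ) (t : ℝ) (i j : ι) :
    HasDerivAt (fun s : ℝ => NormedSpace.exp (s • M) i j)
      ((M * NormedSpace.exp (t • M)) i j) t := by
  let _ : NormedRing (Matrix ι ι ℂ) := Matrix.linftyOpNormedRing
  let _ : NormedAlgebra ℝ (Matrix ι ι ℂ) := Matrix.linftyOpNormedAlgebra
  exact hasDerivAt_pi.1 (hasDerivAt_pi.1 (hasDerivAt_exp_smul_const' M t) i) j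

theorem eq_vecMul_exp_smul_of_hasDerivAt {M : Matrix ι ι ℂ} {F : ℝ → ι → ℂ}
    (hF : ∀ t, HasDerivAt F (F t ᵥ* M) t) (t : ℝ) : F t = F 0 ᵥ* NormedSpace.exp (t • M) := by
  have hconst (s : ℝ) : HasDerivAt (fun s => F s ᵥ* NormedSpace.exp (s • -M)) 0 s := by
    refine hasDerivAt_pi.2 fun j => ?_
    have h := HasDerivAt.fun_sum (u := Finset.univ) fun i _ =>
      (hasDerivAt_pi.1 (hF s) i).mul (hasDerivAt_matrix_exp_smul_apply (-M) s i j)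
    refine h.congr_deriv ?_
    rw [Finset.sum_add_distrib]
    change (F s ᵥ* M ᵥ* NormedSpace.exp (s • -M)) j +
      (F s ᵥ* (-M * NormedSpace.exp (s • -M))) j = 0
    rw [vecMul_vecMul, neg_mul, vecMul_neg, Pi.neg_apply, add_neg_cancel]
  have h0 := is_const_of_deriv_eq_zero (fun s => (hconst s).differentiableAt)
    (fun s => (hconst s).deriv) t 0
  have hinv : NormedSpace.exp (t • -M) * NormedSpace.exp (t • M) = 1 := by
    rw [smul_neg, ← Matrix.exp_add_of_commute _ _ (Commute.refl (t • M)).neg_left,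
      neg_add_cancel, NormedSpace.exp_zero]
  calc F t = F t ᵥ* NormedSpace.exp (t • -M) ᵥ* NormedSpace.exp (t • M) := by
        rw [vecMul_vecMul, hinv, vecMul_one]
    _ = F 0 ᵥ* NormedSpace.exp (t • M) := by
        rw [h0, zero_smul, NormedSpace.exp_zero, vecMul_one]

theorem mul_eq_mul_of_exp_smul_mul_eq {A : Matrix ι ι ℂ} {B : Matrix κ κ ℂ} {T : Matrix ι κ ℂ}
    (h : ∀ t : ℝ, NormedSpace.exp (t • A) * T = T * NormedSpace.exp (t • B)) : A * T = T * B := by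
  ext i j
  have hA := HasDerivAt.fun_sum (u := Finset.univ) fun k _ =>
    (hasDerivAt_matrix_exp_smul_apply A 0 i k).mul_const (T k j)
  have hB := HasDerivAt.fun_sum (u := Finset.univ) fun k _ =>
    (hasDerivAt_matrix_exp_smul_apply B 0 k j).const_mul (T i k)
  have heq := hA.unique (hB.congr_of_eventuallyEq (Filter.Eventually.of_forall fun t =>
    congrFun (congrFun (h t) i) j))
  simp only [zero_smul, NormedSpace.exp_zero, Matrix.mul_one] at heq
  exact heq

theorem exp_smul_mem_unitaryGroup {M : Matrix ι ι ℂ} (hM : Mᴴ = -M) (t : ℝ) :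
    NormedSpace.exp (t • M) ∈ unitaryGroup ι ℂ := by
  rw [mem_unitaryGroup_iff', star_eq_conjTranspose, ← Matrix.exp_conjTranspose, conjTranspose_smul,
    hM, star_trivial, smul_neg, ← Matrix.exp_add_of_commute _ _ (Commute.refl (t • M)).neg_left,
    neg_add_cancel, NormedSpace.exp_zero]

end MatrixExp

section SchurOrthogonality

variable {G ι κ : Type*} [Group G] [MeasurableSpace G] [Fintype ι] [Fintype κ]
  [DecidableEq ι] [DecidableEq κ] {μ : Measure G} [IsFiniteMeasure μ]
  {ρ : G →* unitaryGroup ι ℂ} {σ : G →* unitaryGroup κ ℂ}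

/-- The matrix of the inner products of the `n`-th column of the unitary representation `ρ` with
the `n'`-th column of `σ`; it intertwines `σ` and `ρ`. -/
def columnGram (μ : Measure G) (ρ : G →* unitaryGroup ι ℂ) (σ : G →* unitaryGroup κ ℂ)
    (n : ι) (n' : κ) : Matrix ι κ ℂ :=
  Matrix.of fun m m' => ∫ g, (ρ g).1 m n * star ((σ g).1 m' n') ∂μ

theorem integrable_entry_mul_star_entry
    (hρ : ∀ i j, AEStronglyMeasurable (fun g => (ρ g).1 i j) μ)
    (hσ : ∀ i j, AEStronglyMeasurable (fun g => (σ g).1 i j) μ) (m n : ι) (m' n' : κ) :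
    Integrable (fun g => (ρ g).1 m n * star ((σ g).1 m' n')) μ := by
  refine Integrable.of_bound ((hρ m n).mul (hσ m' n').star) 1
    (Filter.Eventually.of_forall fun g => ?_)
  rw [norm_mul, norm_star]
  exact mul_le_one₀ (entry_norm_bound_of_unitary (ρ g).2 m n) (norm_nonneg _)
    (entry_norm_bound_of_unitary (σ g).2 m' n')

theorem mul_columnGram [MeasurableMul G] [μ.IsMulLeftInvariant]
    (hρ : ∀ i j, AEStronglyMeasurable (fun g => (ρ g).1 i j) μ)
    (hσ : ∀ i j, AEStronglyMeasurable (fun g => (σ g).1 i j) μ) (n : ι) (n' : κ) (g : G) :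
    (ρ g).1 * columnGram μ ρ σ n n' = columnGram μ ρ σ n n' * (σ g).1 := by
  have hint := integrable_entry_mul_star_entry hρ hσ
  ext m m'
  calc ((ρ g).1 * columnGram μ ρ σ n n') m m'
      = ∫ h, (ρ (g * h)).1 m n * star ((σ h).1 m' n') ∂μ := by
        simp only [Matrix.mul_apply, columnGram, of_apply, map_mul, Submonoid.coe_mul,
          Finset.sum_mul, mul_assoc]
        rw [integral_finsetSum _ fun i _ => (hint i n m' n').const_mul _]
        simp only [integral_const_mul]
    _ = ∫ h, (ρ h).1 m n * star ((σ (g⁻¹ * h)).1 m' n') ∂μ := by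
        rw [← integral_mul_left_eq_self _ g⁻¹]
        simp only [mul_inv_cancel_left]
    _ = (columnGram μ ρ σ n n' * (σ g).1) m m' := by
        have hstar (j : κ) : star ((σ g⁻¹).1 m' j) = (σ g).1 j m' := by
          rw [map_inv, UnitaryGroup.inv_val, star_apply, star_star]
        simp only [Matrix.mul_apply, columnGram, of_apply, map_mul, Submonoid.coe_mul, star_sum,
          star_mul', Finset.mul_sum, hstar, mul_left_comm _ ((σ g).1 _ _)]
        rw [integral_finsetSum _ fun j _ => (hint m n j n').const_mul _]
        simp only [integral_const_mul, mul_comm]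

theorem integral_entry_mul_star_entry_eq_zero [MeasurableMul G] [μ.IsMulLeftInvariant]
    (hρ : ∀ i j, AEStronglyMeasurable (fun g => (ρ g).1 i j) μ)
    (hσ : ∀ i j, AEStronglyMeasurable (fun g => (σ g).1 i j) μ)
    (h : ∀ T : Matrix ι κ ℂ, (∀ g, (ρ g).1 * T = T * (σ g).1) → T = 0) (m n : ι) (m' n' : κ) :
    ∫ g, (ρ g).1 m n * star ((σ g).1 m' n') ∂μ = 0 :=
  congrFun (congrFun (h _ (mul_columnGram hρ hσ n n')) m) m'

theorem trace_columnGram_self (hρ : ∀ i j, AEStronglyMeasurable (fun g => (ρ g).1 i j) μ)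
    (n n' : ι) : (columnGram μ ρ ρ n n').trace = if n = n' then (μ.real Set.univ : ℂ) else 0 := by
  have hcol (g : G) : ∑ m, (ρ g).1 m n * star ((ρ g).1 m n') = (1 : Matrix ι ι ℂ) n' n := by
    rw [← Unitary.star_mul_self_of_mem (ρ g).2, Matrix.mul_apply]
    exact Finset.sum_congr rfl fun m _ => mul_comm _ _
  calc (columnGram μ ρ ρ n n').trace
      = ∫ g, ∑ m, (ρ g).1 m n * star ((ρ g).1 m n') ∂μ :=
        (integral_finsetSum _ fun m _ => integrable_entry_mul_star_entry hρ hρ m n m n').symm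
    _ = if n = n' then (μ.real Set.univ : ℂ) else 0 := by
        simp only [hcol, integral_const, Matrix.one_apply, smul_ite, smul_zero, eq_comm]
        simp

theorem integral_entry_mul_star_entry_self [MeasurableMul G] [μ.IsMulLeftInvariant]
    [IsProbabilityMeasure μ]
    (hρ : ∀ i j, AEStronglyMeasurable (fun g => (ρ g).1 i j) μ)
    (h : ∀ T : Matrix ι ι ℂ, (∀ g, (ρ g).1 * T = T * (ρ g).1) → ∃ c : ℂ, T = c • 1)
    (m n m' n' : ι) :
    ∫ g, (ρ g).1 m n * star ((ρ g).1 m' n') ∂μ =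
      if m = m' ∧ n = n' then (Fintype.card ι : ℂ)⁻¹ else 0 := by
  obtain ⟨c, hc⟩ := h _ (mul_columnGram hρ hρ n n')
  have hcard : (Fintype.card ι : ℂ) ≠ 0 :=
    Nat.cast_ne_zero.2 (Fintype.card_pos_iff.2 ⟨m⟩).ne'
  have htrace : c * Fintype.card ι = if n = n' then 1 else 0 := by
    simpa [hc] using trace_columnGram_self (μ := μ) hρ n n'
  have hval : c = if n = n' then (Fintype.card ι : ℂ)⁻¹ else 0 := by
    rw [← mul_inv_cancel_right₀ hcard c, htrace, ite_mul, one_mul, zero_mul]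
  have hentry : ∫ g, (ρ g).1 m n * star ((ρ g).1 m' n') ∂μ = (c • (1 : Matrix ι ι ℂ)) m m' :=
    congrFun (congrFun hc m) m'
  rw [hentry, hval, Matrix.smul_apply, one_apply, smul_eq_mul]
  by_cases hm : m = m' <;> simp [hm]

end SchurOrthogonality

section OrthogonalFamily

variable {𝕜 ι E : Type*} [RCLike 𝕜] [NormedAddCommGroup E] [InnerProductSpace 𝕜 E]
  [CompleteSpace E]

theorem hasSum_smul_iff_forall_inner_eq {v : ι → E}
    (hv : Pairwise fun i j => inner 𝕜 (v i) (v j) = 0)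
    (hv0 : ∀ i, v i ≠ 0) (hspan : (Submodule.span 𝕜 (Set.range v)).topologicalClosure = ⊤)
    {x : E} {c : ι → 𝕜} :
    HasSum (fun i => c i • v i) x ↔ ∀ i, inner 𝕜 (v i) x = c i * (‖v i‖ : 𝕜) ^ 2 := by
  have hnorm (i : ι) : (‖v i‖ : 𝕜) ≠ 0 := RCLike.ofReal_ne_zero.2 (norm_ne_zero_iff.2 (hv0 i))
  let u : ι → E := fun i => (‖v i‖ : 𝕜)⁻¹ • v i
  have hvu (i : ι) : v i = (‖v i‖ : 𝕜) • u i := (smul_inv_smul₀ (hnorm i) (v i)).symm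
  have hu : Orthonormal 𝕜 u :=
    ⟨fun i => norm_smul_inv_norm (hv0 i), fun i j hij => by
      simp only [u, inner_smul_left, inner_smul_right, hv hij, mul_zero]⟩
  have hu_span : ⊤ ≤ (Submodule.span 𝕜 (Set.range u)).topologicalClosure := by
    rw [← hspan]
    refine Submodule.topologicalClosure_mono (Submodule.span_le.2 ?_)
    rintro _ ⟨i, rfl⟩
    rw [hvu]
    exact Submodule.smul_mem _ _ (Submodule.subset_span ⟨i, rfl⟩)
  let b : HilbertBasis ι 𝕜 E := HilbertBasis.mk hu hu_span
  have hb : ⇑b = u := HilbertBasis.coe_mk hu hu_span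
  constructor
  · intro h i
    have hi := h.mapL (innerSL 𝕜 (v i))
    simp only [innerSL_apply_apply, inner_smul_right] at hi
    refine hi.unique ?_
    rw [← inner_self_eq_norm_sq_to_K]
    exact hasSum_single i fun j hj => by rw [hv hj.symm, mul_zero]
  · intro h
    convert b.hasSum_repr x using 2 with i
    rw [b.repr_apply_apply, hb]
    simp only [u, inner_smul_left, h i, map_inv₀, RCLike.conj_ofReal, smul_smul]
    congr 1
    field_simp [hnorm i]

end OrthogonalFamily

/-! ### The spin monomials -/

/-- The normalized monomial `z ^ p / √(p !)`, that is, the `p`-th state of a harmonic oscillator in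
the Bargmann representation. -/
def oscillator (p : ℕ) (z : ℂ) : ℂ := z ^ p / (√(p.factorial : ℝ) : ℝ)

theorem mul_oscillator (p : ℕ) (z : ℂ) :
    z * oscillator p z = (√((p : ℝ) + 1) : ℝ) * oscillator (p + 1) z := by
  have hp : ((√((p : ℝ) + 1) : ℝ) : ℂ) ≠ 0 := Complex.ofReal_ne_zero.2 (by positivity)
  have hf : ((√(p.factorial : ℝ) : ℝ) : ℂ) ≠ 0 := Complex.ofReal_ne_zero.2 (by positivity)
  rw [oscillator, oscillator, Nat.factorial_succ, Nat.cast_mul, Real.sqrt_mul (by positivity),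
    Nat.cast_succ, Complex.ofReal_mul]
  field_simp
  ring

theorem hasDerivAt_oscillator (p : ℕ) (z : ℂ) :
    HasDerivAt (oscillator p) ((√(p : ℝ) : ℝ) * oscillator (p - 1) z) z := by
  refine ((hasDerivAt_pow p z).div_const _).congr_deriv ?_
  cases p with
  | zero => simp
  | succ p =>
    have hp : ((√((p : ℝ) + 1) : ℝ) : ℂ) ≠ 0 := Complex.ofReal_ne_zero.2 (by positivity)
    have hf : ((√(p.factorial : ℝ) : ℝ) : ℂ) ≠ 0 := Complex.ofReal_ne_zero.2 (by positivity)
    have hsq : ((√((p : ℝ) + 1) : ℝ) : ℂ) ^ 2 = p + 1 := by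
      exact_mod_cast Real.sq_sqrt (by positivity : (0 : ℝ) ≤ p + 1)
    rw [oscillator, Nat.factorial_succ, Nat.cast_mul, Real.sqrt_mul (by positivity),
      Nat.cast_succ, Nat.cast_succ, Complex.ofReal_mul, Nat.add_sub_cancel, ← hsq]
    field_simp

theorem mul_sqrt_mul_oscillator_pred (p : ℕ) (z : ℂ) :
    z * ((√(p : ℝ) : ℝ) * oscillator (p - 1) z) = p * oscillator p z := by
  cases p with
  | zero => simp
  | succ p =>
    rw [mul_left_comm, Nat.add_sub_cancel, mul_oscillator, ← mul_assoc, ← Complex.ofReal_mul,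
      Nat.cast_succ, Real.mul_self_sqrt (by positivity)]
    push_cast
    ring

namespace Idx

variable {l : ℕ}

/-- The number `l + m` of spin-up quanta in the state of weight `m`. -/
def up (m : Idx l) : ℕ := (l + m.1).toNat

/-- The number `l - m` of spin-down quanta in the state of weight `m`. -/
def down (m : Idx l) : ℕ := (l - m.1).toNat

theorem natCast_up (m : Idx l) : (m.up : ℤ) = l + m.1 := by
  have := Finset.mem_Icc.1 m.2
  exact Int.toNat_of_nonneg (by omega)

theorem natCast_down (m : Idx l) : (m.down : ℤ) = l - m.1 := by
  have := Finset.mem_Icc.1 m.2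
  exact Int.toNat_of_nonneg (by omega)

theorem up_add_down (m : Idx l) : m.up + m.down = 2 * l := by
  have := m.natCast_up
  have := m.natCast_down
  omega

theorem up_injective : Function.Injective (up : Idx l → ℕ) := fun m n h => by
  have := m.natCast_up
  have := n.natCast_up
  exact Subtype.ext (by omega)

theorem add_one_eq_iff {m n : Idx l} : m.1 + 1 = n.1 ↔ n.up = m.up + 1 := by
  have := m.natCast_up
  have := n.natCast_up
  omega

theorem exists_up_eq {p : ℕ} (hp : p ≤ 2 * l) : ∃ m : Idx l, m.up = p :=
  ⟨⟨p - l, Finset.mem_Icc.2 (by omega)⟩, by simp [up]⟩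

end Idx

/-- The operator `Q^l` with complex entries. -/
def complexLadder (l : ℕ) : Matrix (Idx l) (Idx l) ℂ := (ladder l).map (↑)

/-- The operator `Λ^l` that multiplies the state of weight `m` by `m`. -/
def weightMatrix (l : ℕ) : Matrix (Idx l) (Idx l) ℂ := diagonal fun m => (m.1 : ℂ)

theorem complexLadder_apply (l : ℕ) (m n : Idx l) :
    complexLadder l m n = if n.up = m.up + 1 then ((√(m.down * (m.up + 1)) : ℝ) : ℂ) else 0 := by
  have hup : (m.up : ℝ) = l + m.1 := by exact_mod_cast congrArg (Int.cast : ℤ → ℝ) m.natCast_up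
  have hdown : (m.down : ℝ) = l - m.1 := by
    exact_mod_cast congrArg (Int.cast : ℤ → ℝ) m.natCast_down
  rw [complexLadder, map_apply, ladder, of_apply, hup, hdown]
  simp only [Idx.add_one_eq_iff, apply_ite (Complex.ofReal), Complex.ofReal_zero]

theorem sum_mul_complexLadder (l : ℕ) (f : ℕ → ℕ → ℂ) (m : Idx l) :
    ∑ k : Idx l, f k.up k.down * complexLadder l k m =
      f (m.up - 1) (m.down + 1) * (√(m.up * (m.down + 1)) : ℝ) := by
  rcases Nat.eq_zero_or_pos m.up with h0 | hpos
  · rw [h0, Finset.sum_eq_zero fun k _ => ?_]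
    · simp
    · rw [complexLadder_apply, if_neg (by omega), mul_zero]
  · have hm := m.up_add_down
    obtain ⟨n, hn⟩ := Idx.exists_up_eq (l := l) (p := m.up - 1) (by omega)
    have hnd := n.up_add_down
    have hd : n.down = m.down + 1 := by omega
    have hup : (n.up : ℝ) + 1 = m.up := by exact_mod_cast (by omega : n.up + 1 = m.up)
    rw [Finset.sum_eq_single n, complexLadder_apply, if_pos (by omega), ← hn, hd, hup, mul_comm
      (m.up : ℝ), Nat.cast_succ]
    · intro k _ hk
      rw [complexLadder_apply, if_neg, mul_zero]
      exact fun h => hk (Idx.up_injective (by omega))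
    · simp

theorem sum_mul_complexLadder_transpose (l : ℕ) (f : ℕ → ℕ → ℂ) (m : Idx l) :
    ∑ k : Idx l, f k.up k.down * complexLadder l m k =
      f (m.up + 1) (m.down - 1) * (√(m.down * (m.up + 1)) : ℝ) := by
  have hm := m.up_add_down
  rcases Nat.eq_zero_or_pos m.down with h0 | hpos
  · rw [h0, Finset.sum_eq_zero fun k _ => ?_]
    · simp
    · have := k.up_add_down
      rw [complexLadder_apply, if_neg (by omega), mul_zero]
  · obtain ⟨n, hn⟩ := Idx.exists_up_eq (l := l) (p := m.up + 1) (by omega)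
    have hnd := n.up_add_down
    have hd : n.down = m.down - 1 := by omega
    rw [Finset.sum_eq_single n, complexLadder_apply, if_pos hn, hn, hd]
    · intro k _ hk
      rw [complexLadder_apply, if_neg, mul_zero]
      exact fun h => hk (Idx.up_injective (h.trans hn.symm))
    · simp

/-- The basis `v₀ ^ (l + m) v₁ ^ (l - m) / √((l + m)! (l - m)!)` of the forms of degree `2l` in two
variables, on which `SL(2, ℂ)` acts by `D^l` (Schwinger's oscillator model). -/
def spinMonomial (l : ℕ) (v : Fin 2 → ℂ) (m : Idx l) : ℂ :=
  oscillator m.up (v 0) * oscillator m.down (v 1)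

theorem spinMonomial_vecMul_complexLadder (l : ℕ) (v : Fin 2 → ℂ) (m : Idx l) :
    (spinMonomial l v ᵥ* complexLadder l) m =
      v 1 * ((√(m.up : ℝ) : ℝ) * oscillator (m.up - 1) (v 0) * oscillator m.down (v 1)) := by
  refine (sum_mul_complexLadder l (fun p q => oscillator p (v 0) * oscillator q (v 1)) m).trans ?_
  rw [Real.sqrt_mul (Nat.cast_nonneg _), Complex.ofReal_mul]
  linear_combination (-(√(m.up : ℝ) : ℝ) * oscillator (m.up - 1) (v 0)) *
    mul_oscillator m.down (v 1)

theorem spinMonomial_vecMul_complexLadder_transpose (l : ℕ) (v : Fin 2 → ℂ) (m : Idx l) :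
    (spinMonomial l v ᵥ* (complexLadder l)ᵀ) m =
      v 0 * (oscillator m.up (v 0) * ((√(m.down : ℝ) : ℝ) * oscillator (m.down - 1) (v 1))) := by
  refine (sum_mul_complexLadder_transpose l
    (fun p q => oscillator p (v 0) * oscillator q (v 1)) m).trans ?_
  rw [Real.sqrt_mul (Nat.cast_nonneg _), Complex.ofReal_mul]
  linear_combination (-(√(m.down : ℝ) : ℝ) * oscillator (m.down - 1) (v 1)) *
    mul_oscillator m.up (v 0)

/-- The action of the matrix `X ∈ 𝔤𝔩(2, ℂ)` on the forms of degree `2l` in the basis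
`spinMonomial`. -/
def spinGenerator (l : ℕ) (X : Matrix (Fin 2) (Fin 2) ℂ) : Matrix (Idx l) (Idx l) ℂ :=
  diagonal (fun m => X 0 0 * m.up + X 1 1 * m.down) + X 1 0 • complexLadder l +
    X 0 1 • (complexLadder l)ᵀ

theorem hasDerivAt_spinMonomial (l : ℕ) (X : Matrix (Fin 2) (Fin 2) ℂ) {u : ℝ → Fin 2 → ℂ} {t : ℝ}
    (hu : HasDerivAt u (u t ᵥ* X) t) :
    HasDerivAt (fun s => spinMonomial l (u s)) (spinMonomial l (u t) ᵥ* spinGenerator l X) t := by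
  refine hasDerivAt_pi.2 fun m => ?_
  have hu0 := (hasDerivAt_oscillator m.up (u t 0)).comp t (hasDerivAt_pi.1 hu 0)
  have hu1 := (hasDerivAt_oscillator m.down (u t 1)).comp t (hasDerivAt_pi.1 hu 1)
  have hX (j : Fin 2) : (u t ᵥ* X) j = u t 0 * X 0 j + u t 1 * X 1 j := vec2_dotProduct _ _
  refine (hu0.mul hu1).congr_deriv ?_
  simp only [Function.comp_apply, spinGenerator, vecMul_add, Pi.add_apply, vecMul_smul,
    Pi.smul_apply, smul_eq_mul, spinMonomial_vecMul_complexLadder, vecMul_diagonal,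
    spinMonomial_vecMul_complexLadder_transpose, hX]
  rw [spinMonomial]
  linear_combination X 0 0 * oscillator m.down (u t 1) * mul_sqrt_mul_oscillator_pred m.up (u t 0) +
    X 1 1 * oscillator m.up (u t 0) * mul_sqrt_mul_oscillator_pred m.down (u t 1)

theorem spinMonomial_vecMul_eq_vecMul_exp (l : ℕ) {X : Matrix (Fin 2) (Fin 2) ℂ}
    {U : ℝ → Matrix (Fin 2) (Fin 2) ℂ} (hU0 : U 0 = 1)
    (hU : ∀ t i j, HasDerivAt (fun s => U s i j) ((U t * X) i j) t) (v : Fin 2 → ℂ) (t : ℝ) :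
    spinMonomial l (v ᵥ* U t) = spinMonomial l v ᵥ* NormedSpace.exp (t • spinGenerator l X) := by
  have hvU (s : ℝ) : HasDerivAt (fun s => v ᵥ* U s) (v ᵥ* U s ᵥ* X) s := by
    rw [vecMul_vecMul]
    exact hasDerivAt_pi.2 fun j => HasDerivAt.fun_sum (u := Finset.univ) fun i _ =>
      (hU s i j).const_mul (v i)
  rw [eq_vecMul_exp_smul_of_hasDerivAt (fun s => hasDerivAt_spinMonomial l X (hvU s)) t, hU0,
    vecMul_one]

theorem eq_zero_of_forall_sum_spinMonomial_mul_eq_zero {l : ℕ} {c : Idx l → ℂ}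
    (h : ∀ v, ∑ m, spinMonomial l v m * c m = 0) : c = 0 := by
  let P : Polynomial ℂ := ∑ m : Idx l, Polynomial.monomial m.up
    (c m * oscillator m.down 1 / (√(m.up.factorial : ℝ) : ℝ))
  have hP : P = 0 := by
    refine Polynomial.funext fun t => ?_
    rw [Polynomial.eval_zero, ← h ![t, 1]]
    simp only [P, Polynomial.eval_finsetSum, Polynomial.eval_monomial, spinMonomial, oscillator,
      cons_val_zero, cons_val_one]
    exact Finset.sum_congr rfl fun m _ => by ring
  ext n
  have hcoeff : P.coeff n.up = c n * oscillator n.down 1 / (√(n.up.factorial : ℝ) : ℝ) := by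
    simp only [P, Polynomial.finsetSum_coeff, Polynomial.coeff_monomial,
      Idx.up_injective.eq_iff, Finset.sum_ite_eq', Finset.mem_univ, if_true]
  rw [hP, Polynomial.coeff_zero, eq_comm, oscillator, one_pow] at hcoeff
  have hup : √(n.up.factorial : ℝ) ≠ 0 := by positivity
  have hdown : √(n.down.factorial : ℝ) ≠ 0 := by positivity
  simpa [hup, hdown] using hcoeff

theorem eq_of_forall_spinMonomial_vecMul_eq {l : ℕ} {M N : Matrix (Idx l) (Idx l) ℂ}
    (h : ∀ v, spinMonomial l v ᵥ* M = spinMonomial l v ᵥ* N) : M = N := by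
  rw [← sub_eq_zero]
  ext m n
  refine congrFun (eq_zero_of_forall_sum_spinMonomial_mul_eq_zero (c := fun k => (M - N) k n)
    fun v => ?_) m
  exact (congrFun (vecMul_sub M N (spinMonomial l v)) n).trans
    (congrFun (sub_eq_zero.2 (h v)) n)

theorem spinMonomial_neg (l : ℕ) (v : Fin 2 → ℂ) : spinMonomial l (-v) = spinMonomial l v := by
  ext m
  have hsign : (-1 : ℂ) ^ m.up * (-1) ^ m.down = 1 := by
    rw [← pow_add, m.up_add_down, pow_mul, neg_one_sq, one_pow]
  simp only [spinMonomial, oscillator, Pi.neg_apply, neg_pow (v _)]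
  linear_combination v 0 ^ m.up / (√(m.up.factorial : ℝ) : ℝ) *
    (v 1 ^ m.down / (√(m.down.factorial : ℝ) : ℝ)) * hsign

/-! ### The double cover of `SO(3)` -/

section
attribute [local instance] Matrix.linftyOpNormedRing Matrix.linftyOpNormedAlgebra

theorem exp_smul_map_ofReal {ι : Type*} [Fintype ι] [DecidableEq ι] (M : Matrix ι ι ℝ) (t : ℝ) :
    (NormedSpace.exp (t • M)).map ((↑) : ℝ → ℂ) =
      NormedSpace.exp (t • M.map ((↑) : ℝ → ℂ)) := by
  have h := NormedSpace.map_exp (Complex.ofRealHom.mapMatrix (m := ι))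
    (continuous_id.matrix_map Complex.continuous_ofReal) (t • M)
  refine h.trans (congrArg NormedSpace.exp ?_)
  ext i j
  simp

end

/-- The infinitesimal generator of the rotations around the `z`-axis in the representation `D^l`. -/
def generatorZ (l : ℕ) : Matrix (Idx l) (Idx l) ℂ := -Complex.I • weightMatrix l

/-- The infinitesimal generator of the rotations around the `y`-axis in the representation `D^l`. -/
def generatorY (l : ℕ) : Matrix (Idx l) (Idx l) ℂ :=
  (1 / 2 : ℂ) • (complexLadder l - (complexLadder l)ᵀ)

theorem exp_smul_generatorZ (l : ℕ) (θ : ℝ) : NormedSpace.exp (θ • generatorZ l) =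
    diagonal fun m : Idx l => Complex.exp (-Complex.I * m.1 * θ) := by
  have h : θ • generatorZ l = diagonal fun m : Idx l => -Complex.I * m.1 * θ := by
    ext m n
    by_cases hmn : m = n
    · subst hmn; simp [generatorZ, weightMatrix, mul_comm]
    · simp [generatorZ, weightMatrix, hmn]
  rw [h, Matrix.exp_diagonal]
  congr 1
  ext m
  rw [Pi.coe_exp, Complex.exp_eq_exp_ℂ]

theorem exp_smul_generatorY (l : ℕ) (θ : ℝ) :
    NormedSpace.exp (θ • generatorY l) = (wignerSmallD l θ).map ((↑) : ℝ → ℂ) := by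
  rw [wignerSmallD, exp_smul_map_ofReal]
  congr 1
  ext m n
  simp only [generatorY, complexLadder, Matrix.smul_apply, Matrix.sub_apply, map_apply,
    transpose_apply, smul_eq_mul, Complex.real_smul, Complex.ofReal_sub, Complex.ofReal_div,
    Complex.ofReal_ofNat]
  ring

theorem wignerD_eq_exp_mul_exp_mul_exp (l : ℕ) (A : SO3) : wignerD l A =
    NormedSpace.exp (eulerAlpha A • generatorZ l) * NormedSpace.exp (eulerBeta A • generatorY l) *
      NormedSpace.exp (eulerGamma A • generatorZ l) := by
  ext m n
  rw [exp_smul_generatorZ, exp_smul_generatorZ, exp_smul_generatorY, mul_diagonal, diagonal_mul]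
  rfl

theorem conjTranspose_generatorZ (l : ℕ) : (generatorZ l)ᴴ = -generatorZ l := by
  ext m n
  by_cases h : m = n
  · subst h; simp [generatorZ, weightMatrix]
  · simp [generatorZ, weightMatrix, h, Ne.symm h]

theorem conjTranspose_generatorY (l : ℕ) : (generatorY l)ᴴ = -generatorY l := by
  ext m n
  simp only [generatorY, complexLadder, conjTranspose_apply, Matrix.smul_apply, Matrix.sub_apply,
    map_apply, transpose_apply, smul_eq_mul, star_mul', star_div₀, star_one, star_ofNat, star_sub,
    RCLike.star_def, Complex.conj_ofReal, Matrix.neg_apply]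
  ring

theorem wignerD_mem_unitaryGroup (l : ℕ) (A : SO3) : wignerD l A ∈ unitaryGroup (Idx l) ℂ := by
  rw [wignerD_eq_exp_mul_exp_mul_exp]
  exact mul_mem (mul_mem (exp_smul_mem_unitaryGroup (conjTranspose_generatorZ l) _)
    (exp_smul_mem_unitaryGroup (conjTranspose_generatorY l) _))
    (exp_smul_mem_unitaryGroup (conjTranspose_generatorZ l) _)

/-- The Pauli matrices, an orthogonal basis of the traceless `2 × 2` matrices for the form
`tr (X Y)`. -/
def pauli : Fin 3 → Matrix (Fin 2) (Fin 2) ℂ :=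
  ![!![0, 1; 1, 0], !![0, -Complex.I; Complex.I, 0], !![1, 0; 0, -1]]

theorem trace_pauli (i : Fin 3) : (pauli i).trace = 0 := by
  fin_cases i <;> simp [pauli, trace_fin_two]

theorem trace_pauli_mul_pauli (i j : Fin 3) :
    (pauli i * pauli j).trace = if i = j then 2 else 0 := by
  fin_cases i <;> fin_cases j <;> simp [pauli, trace_fin_two, one_add_one_eq_two]

theorem eq_sum_trace_smul_pauli {M : Matrix (Fin 2) (Fin 2) ℂ} (hM : M.trace = 0) :
    M = ∑ i, ((pauli i * M).trace / 2) • pauli i := by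
  rw [trace_fin_two] at hM
  ext i j
  fin_cases i <;> fin_cases j <;>
    simp [pauli, Fin.sum_univ_three, trace_fin_two, mul_apply, Fin.sum_univ_two]
  · linear_combination hM / 2
  · linear_combination (M 0 1 - M 1 0) / 2 * Complex.I_sq
  · linear_combination (M 1 0 - M 0 1) / 2 * Complex.I_sq
  · linear_combination hM / 2

/-- The matrix, in the basis of the Pauli matrices, of the map `M ↦ U * M * U.adjugate` on the
traceless `2 × 2` matrices. For `U ∈ SU(2)` this map is the conjugation by `U`, so that
`spinRotation` is the double cover of `SO(3)`. -/
def spinRotation (U : Matrix (Fin 2) (Fin 2) ℂ) : Matrix (Fin 3) (Fin 3) ℂ :=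
  Matrix.of fun i j => (pauli i * (U * pauli j * U.adjugate)).trace / 2

theorem mul_pauli_mul_adjugate (U : Matrix (Fin 2) (Fin 2) ℂ) (j : Fin 3) :
    U * pauli j * U.adjugate = ∑ i, spinRotation U i j • pauli i := by
  refine eq_sum_trace_smul_pauli ?_
  rw [trace_mul_cycle, adjugate_mul, Matrix.smul_mul, Matrix.one_mul, trace_smul, trace_pauli,
    smul_zero]

theorem spinRotation_one : spinRotation 1 = 1 := by
  ext i j
  simp [spinRotation, trace_pauli_mul_pauli, one_apply, ite_div]

theorem spinRotation_mul (U V : Matrix (Fin 2) (Fin 2) ℂ) :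
    spinRotation (U * V) = spinRotation U * spinRotation V := by
  have hconj (j : Fin 3) : U * V * pauli j * (U * V).adjugate =
      ∑ i, (spinRotation U * spinRotation V) i j • pauli i :=
    calc U * V * pauli j * (U * V).adjugate
        = U * (V * pauli j * V.adjugate) * U.adjugate := by
          simp only [adjugate_mul_distrib, Matrix.mul_assoc]
      _ = ∑ k, spinRotation V k j • ∑ i, spinRotation U i k • pauli i := by
          rw [mul_pauli_mul_adjugate V]
          simp only [Finset.mul_sum, Finset.sum_mul, Matrix.mul_smul, Matrix.smul_mul,
            mul_pauli_mul_adjugate U]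
      _ = ∑ i, (spinRotation U * spinRotation V) i j • pauli i := by
          simp only [Finset.smul_sum, smul_smul, mul_apply, Finset.sum_smul]
          rw [Finset.sum_comm]
          simp only [mul_comm]
  ext i j
  rw [spinRotation, of_apply, hconj]
  simp [Finset.mul_sum, trace_sum, trace_pauli_mul_pauli]

theorem eq_one_or_eq_neg_one_of_spinRotation_eq_one {U : Matrix (Fin 2) (Fin 2) ℂ}
    (hdet : U.det = 1) (hU : spinRotation U = 1) : U = 1 ∨ U = -1 := by
  have hcomm (j : Fin 3) : U * pauli j = pauli j * U := by
    have h := congrArg (· * U) (mul_pauli_mul_adjugate U j)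
    simpa [hU, one_apply, Matrix.mul_assoc, adjugate_mul, hdet] using h
  have h01 : U 0 1 = 0 := by
    have h := congrFun (congrFun (hcomm 2) 0) 1
    simpa [pauli, mul_apply, Fin.sum_univ_two, neg_eq_self] using h
  have h10 : U 1 0 = 0 := by
    have h := congrFun (congrFun (hcomm 2) 1) 0
    simpa [pauli, mul_apply, Fin.sum_univ_two, self_eq_neg] using h
  have h11 : U 1 1 = U 0 0 := by
    have h := congrFun (congrFun (hcomm 0) 1) 0
    simpa [pauli, mul_apply, Fin.sum_univ_two] using h
  have hsq : U 0 0 * U 0 0 = 1 := by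
    rw [det_fin_two] at hdet
    linear_combination hdet + U 1 0 * h01 - U 0 0 * h11
  refine (mul_self_eq_one_iff.1 hsq).imp (fun h => ?_) fun h => ?_ <;>
  · ext i j
    fin_cases i <;> fin_cases j <;> simp [h01, h10, h11, h]

theorem eq_or_eq_neg_of_spinRotation_eq {U V : Matrix (Fin 2) (Fin 2) ℂ} (hU : U.det = 1)
    (hV : V.det = 1) (h : spinRotation U = spinRotation V) : U = V ∨ U = -V := by
  have hdet : (V.adjugate * U).det = 1 := by simp [det_adjugate, hU, hV]
  have hrot : spinRotation (V.adjugate * U) = 1 := by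
    rw [spinRotation_mul, h, ← spinRotation_mul, adjugate_mul, hV, one_smul, spinRotation_one]
  have hUV : U = V * (V.adjugate * U) := by
    rw [← Matrix.mul_assoc, mul_adjugate, hV, one_smul, Matrix.one_mul]
  refine (eq_one_or_eq_neg_one_of_spinRotation_eq_one hdet hrot).imp (fun h1 => ?_) fun h1 => ?_
  · rw [hUV, h1, Matrix.mul_one]
  · rw [hUV, h1, Matrix.mul_neg, Matrix.mul_one]

/-- The lift `exp (-i θ σ_z / 2)` to `SU(2)` of the rotation by the angle `θ` around the
`z`-axis. -/
def spinZ (θ : ℝ) : Matrix (Fin 2) (Fin 2) ℂ :=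
  !![Complex.exp (-Complex.I / 2 * θ), 0; 0, Complex.exp (Complex.I / 2 * θ)]

/-- The lift `exp (-i θ σ_y / 2)` to `SU(2)` of the rotation by the angle `θ` around the
`y`-axis. -/
def spinY (θ : ℝ) : Matrix (Fin 2) (Fin 2) ℂ :=
  !![Complex.cos (θ / 2), -Complex.sin (θ / 2); Complex.sin (θ / 2), Complex.cos (θ / 2)]

theorem det_spinZ (θ : ℝ) : (spinZ θ).det = 1 := by
  rw [spinZ, det_fin_two_of, ← Complex.exp_add]
  simp [neg_div]

theorem det_spinY (θ : ℝ) : (spinY θ).det = 1 := by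
  rw [spinY, det_fin_two_of]
  linear_combination Complex.sin_sq_add_cos_sq (θ / 2 : ℂ)

theorem spinMonomial_vecMul_spinZ (l : ℕ) (v : Fin 2 → ℂ) (θ : ℝ) :
    spinMonomial l (v ᵥ* spinZ θ) = spinMonomial l v ᵥ* NormedSpace.exp (θ • generatorZ l) := by
  let X : Matrix (Fin 2) (Fin 2) ℂ := !![-Complex.I / 2, 0; 0, Complex.I / 2]
  have hup (m : Idx l) : (m.up : ℂ) = l + m.1 := by
    exact_mod_cast congrArg (Int.cast : ℤ → ℂ) m.natCast_up
  have hdown (m : Idx l) : (m.down : ℂ) = l - m.1 := by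
    exact_mod_cast congrArg (Int.cast : ℤ → ℂ) m.natCast_down
  have hX : spinGenerator l X = generatorZ l := by
    ext m n
    by_cases hmn : m = n
    · subst hmn
      simp only [spinGenerator, generatorZ, weightMatrix, X, of_apply, cons_val', cons_val_zero,
        cons_val_one, cons_val_fin_one, zero_smul, add_zero, Matrix.add_apply, diagonal_apply_eq,
        Matrix.zero_apply, Matrix.smul_apply, smul_eq_mul]
      linear_combination -Complex.I / 2 * hup m + Complex.I / 2 * hdown m
    · simp [spinGenerator, generatorZ, weightMatrix, X, hmn]
  have hderiv (a : ℂ) (t : ℝ) :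
      HasDerivAt (fun s : ℝ => Complex.exp (a * s)) (Complex.exp (a * t) * a) t :=
    (((hasDerivAt_id t).ofReal_comp.const_mul a).cexp).congr_deriv (by simp)
  rw [← hX]
  refine spinMonomial_vecMul_eq_vecMul_exp l (U := spinZ) ?_ (fun t i j => ?_) v θ
  · ext i j
    fin_cases i <;> fin_cases j <;> simp [spinZ]
  · fin_cases i <;> fin_cases j <;> simp only [spinZ, X, mul_apply, Fin.sum_univ_two,
      Fin.zero_eta, Fin.mk_one, of_apply, cons_val', cons_val_zero, cons_val_one, cons_val_fin_one,
      mul_zero, zero_mul, add_zero, zero_add]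
    · exact hderiv _ t
    · exact hasDerivAt_const _ _
    · exact hasDerivAt_const _ _
    · exact hderiv _ t

theorem spinMonomial_vecMul_spinY (l : ℕ) (v : Fin 2 → ℂ) (θ : ℝ) :
    spinMonomial l (v ᵥ* spinY θ) = spinMonomial l v ᵥ* NormedSpace.exp (θ • generatorY l) := by
  let X : Matrix (Fin 2) (Fin 2) ℂ := !![0, -1 / 2; 1 / 2, 0]
  have hX : spinGenerator l X = generatorY l := by
    ext m n
    simp only [spinGenerator, generatorY, X, of_apply, cons_val', cons_val_zero, cons_val_one,
      cons_val_fin_one, zero_mul, add_zero, zero_add, diagonal_zero, Matrix.add_apply,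
      Matrix.smul_apply, Matrix.sub_apply, smul_eq_mul, transpose_apply]
    ring
  have hhalf (t : ℝ) : HasDerivAt (fun s : ℝ => (s : ℂ) / 2) (1 / 2) t :=
    (hasDerivAt_id t).ofReal_comp.div_const 2
  have hcos (t : ℝ) := (Complex.hasDerivAt_cos _).comp t (hhalf t)
  have hsin (t : ℝ) := (Complex.hasDerivAt_sin _).comp t (hhalf t)
  rw [← hX]
  refine spinMonomial_vecMul_eq_vecMul_exp l (U := spinY) ?_ (fun t i j => ?_) v θ
  · ext i j
    fin_cases i <;> fin_cases j <;> simp [spinY]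
  · fin_cases i <;> fin_cases j <;> simp only [spinY, X, mul_apply, Fin.sum_univ_two,
      Fin.zero_eta, Fin.mk_one, of_apply, cons_val', cons_val_zero, cons_val_one, cons_val_fin_one,
      mul_zero, add_zero, zero_add]
    · exact (hcos t).congr_deriv (by ring)
    · exact (hsin t).neg.congr_deriv (by ring)
    · exact (hsin t).congr_deriv (by ring)
    · exact (hcos t).congr_deriv (by ring)

theorem spinRotation_spinZ (θ : ℝ) : spinRotation (spinZ θ) = (rotZ θ).map ((↑) : ℝ → ℂ) := by
  have hneg : Complex.exp (-Complex.I / 2 * θ) =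
      Complex.cos (θ / 2) - Complex.sin (θ / 2) * Complex.I := by
    rw [show -Complex.I / 2 * θ = -(θ / 2) * Complex.I by ring, Complex.exp_mul_I,
      Complex.cos_neg, Complex.sin_neg, neg_mul, sub_eq_add_neg]
  have hpos : Complex.exp (Complex.I / 2 * θ) =
      Complex.cos (θ / 2) + Complex.sin (θ / 2) * Complex.I := by
    rw [← Complex.exp_mul_I]
    ring_nf
  have hcos : Complex.cos θ = Complex.cos (θ / 2) ^ 2 - Complex.sin (θ / 2) ^ 2 := by
    rw [← Complex.cos_two_mul', mul_div_cancel₀ _ two_ne_zero]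
  have hsin : Complex.sin θ = 2 * Complex.sin (θ / 2) * Complex.cos (θ / 2) := by
    rw [← Complex.sin_two_mul, mul_div_cancel₀ _ two_ne_zero]
  have hone := Complex.sin_sq_add_cos_sq (θ / 2 : ℂ)
  ext i j
  fin_cases i <;> fin_cases j <;>
    simp [spinRotation, spinZ, rotZ, pauli, trace_fin_two, hneg, hpos, hcos, hsin]
  · linear_combination Complex.sin (θ / 2) ^ 2 * Complex.I_sq
  · linear_combination 2 * Complex.cos (θ / 2) * Complex.sin (θ / 2) * Complex.I_sq
  · linear_combination -2 * Complex.cos (θ / 2) * Complex.sin (θ / 2) * Complex.I_sq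
  · linear_combination (Complex.sin (θ / 2) ^ 2 - Complex.cos (θ / 2) ^ 2 -
      Complex.I ^ 2 * Complex.sin (θ / 2) ^ 2) * Complex.I_sq
  · linear_combination hone - Complex.sin (θ / 2) ^ 2 * Complex.I_sq

theorem spinRotation_spinY (θ : ℝ) : spinRotation (spinY θ) = (rotY θ).map ((↑) : ℝ → ℂ) := by
  have hcos : Complex.cos θ = Complex.cos (θ / 2) ^ 2 - Complex.sin (θ / 2) ^ 2 := by
    rw [← Complex.cos_two_mul', mul_div_cancel₀ _ two_ne_zero]
  have hsin : Complex.sin θ = 2 * Complex.sin (θ / 2) * Complex.cos (θ / 2) := by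
    rw [← Complex.sin_two_mul, mul_div_cancel₀ _ two_ne_zero]
  have hone := Complex.sin_sq_add_cos_sq (θ / 2 : ℂ)
  ext i j
  fin_cases i <;> fin_cases j <;>
    simp [spinRotation, spinY, rotY, pauli, trace_fin_two, hcos, hsin]
  · ring
  · ring
  · ring
  · linear_combination hone -
      (Complex.sin (θ / 2) ^ 2 + Complex.cos (θ / 2) ^ 2) * Complex.I_sq
  · ring
  · ring
  · ring
  · ring

/-! ### The representations `D^l` -/

/-- The lift of `A ∈ SO(3)` to `SU(2)` given by the Euler angles of `A`. -/
def spinLift (A : SO3) : Matrix (Fin 2) (Fin 2) ℂ :=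
  spinZ (eulerAlpha A) * spinY (eulerBeta A) * spinZ (eulerGamma A)

theorem det_spinLift (A : SO3) : (spinLift A).det = 1 := by
  simp only [spinLift, det_mul, det_spinZ, det_spinY, mul_one]

theorem spinRotation_spinLift (A : SO3) :
    spinRotation (spinLift A) = A.1.map ((↑) : ℝ → ℂ) := by
  have hmap (M N : Matrix (Fin 3) (Fin 3) ℝ) :
      (M * N).map ((↑) : ℝ → ℂ) = M.map ((↑) : ℝ → ℂ) * N.map ((↑) : ℝ → ℂ) :=
    Matrix.map_mul (f := Complex.ofRealHom)
  rw [spinLift, spinRotation_mul, spinRotation_mul, spinRotation_spinZ, spinRotation_spinY,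
    spinRotation_spinZ, ← hmap, ← hmap, ← euler_decomposition]

theorem spinMonomial_vecMul_spinLift (l : ℕ) (v : Fin 2 → ℂ) (A : SO3) :
    spinMonomial l (v ᵥ* spinLift A) = spinMonomial l v ᵥ* wignerD l A := by
  rw [spinLift, ← vecMul_vecMul, ← vecMul_vecMul, spinMonomial_vecMul_spinZ,
    spinMonomial_vecMul_spinY, spinMonomial_vecMul_spinZ, vecMul_vecMul, vecMul_vecMul,
    wignerD_eq_exp_mul_exp_mul_exp, Matrix.mul_assoc]

/-- Euler angles are not unique, but the spin monomials do not see the sign of the lift. -/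
theorem spinMonomial_vecMul_eq_vecMul_wignerD {U : Matrix (Fin 2) (Fin 2) ℂ} (hU : U.det = 1)
    {A : SO3} (hA : spinRotation U = A.1.map ((↑) : ℝ → ℂ)) (l : ℕ) (v : Fin 2 → ℂ) :
    spinMonomial l (v ᵥ* U) = spinMonomial l v ᵥ* wignerD l A := by
  rw [← spinMonomial_vecMul_spinLift]
  rcases eq_or_eq_neg_of_spinRotation_eq hU (det_spinLift A)
    (hA.trans (spinRotation_spinLift A).symm) with rfl | rfl
  · rfl
  · rw [vecMul_neg, spinMonomial_neg]

theorem wignerD_mul (l : ℕ) (A B : SO3) : wignerD l (A * B) = wignerD l A * wignerD l B := by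
  have hmap : (A * B).1.map ((↑) : ℝ → ℂ) = A.1.map ((↑) : ℝ → ℂ) * B.1.map ((↑) : ℝ → ℂ) :=
    Matrix.map_mul (f := Complex.ofRealHom)
  refine eq_of_forall_spinMonomial_vecMul_eq fun v => ?_
  rw [← spinMonomial_vecMul_eq_vecMul_wignerD (U := spinLift A * spinLift B),
    ← vecMul_vecMul, spinMonomial_vecMul_spinLift, spinMonomial_vecMul_spinLift, vecMul_vecMul]
  · rw [det_mul, det_spinLift, det_spinLift, mul_one]
  · rw [spinRotation_mul, spinRotation_spinLift, spinRotation_spinLift, hmap]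

theorem rotZ_mem_specialOrthogonalGroup (θ : ℝ) : rotZ θ ∈ specialOrthogonalGroup (Fin 3) ℝ := by
  rw [mem_specialOrthogonalGroup_iff, mem_orthogonalGroup_iff]
  constructor
  · ext i j
    fin_cases i <;> fin_cases j <;> simp [rotZ, mul_apply, Fin.sum_univ_three, ← sq, mul_comm]
  · simp [rotZ, det_fin_three, ← sq]

theorem rotY_mem_specialOrthogonalGroup (θ : ℝ) : rotY θ ∈ specialOrthogonalGroup (Fin 3) ℝ := by
  rw [mem_specialOrthogonalGroup_iff, mem_orthogonalGroup_iff]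
  constructor
  · ext i j
    fin_cases i <;> fin_cases j <;> simp [rotY, mul_apply, Fin.sum_univ_three, ← sq, mul_comm]
  · simp [rotY, det_fin_three, ← sq]

theorem wignerD_rotZ (l : ℕ) (θ : ℝ) :
    wignerD l ⟨rotZ θ, rotZ_mem_specialOrthogonalGroup θ⟩ = NormedSpace.exp (θ • generatorZ l) := by
  refine eq_of_forall_spinMonomial_vecMul_eq fun v => ?_
  rw [← spinMonomial_vecMul_spinZ,
    spinMonomial_vecMul_eq_vecMul_wignerD (det_spinZ θ)
      (A := ⟨rotZ θ, rotZ_mem_specialOrthogonalGroup θ⟩) (spinRotation_spinZ θ)]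

theorem wignerD_rotY (l : ℕ) (θ : ℝ) :
    wignerD l ⟨rotY θ, rotY_mem_specialOrthogonalGroup θ⟩ = NormedSpace.exp (θ • generatorY l) := by
  refine eq_of_forall_spinMonomial_vecMul_eq fun v => ?_
  rw [← spinMonomial_vecMul_spinY,
    spinMonomial_vecMul_eq_vecMul_wignerD (det_spinY θ)
      (A := ⟨rotY θ, rotY_mem_specialOrthogonalGroup θ⟩) (spinRotation_spinY θ)]

/-- The irreducible unitary representation of `SO(3)` of dimension `2 * l + 1`, whose matrix
entries are the Wigner D-functions. -/
def wignerRep (l : ℕ) : SO3 →* unitaryGroup (Idx l) ℂ :=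
  MonoidHom.mk' (fun A => ⟨wignerD l A, wignerD_mem_unitaryGroup l A⟩) fun A B =>
    Subtype.ext (wignerD_mul l A B)

theorem complexLadder_mul_transpose (l : ℕ) : complexLadder l * (complexLadder l)ᵀ =
    diagonal fun m : Idx l => ((l : ℂ) - m.1) * (l + m.1 + 1) := by
  have hup (m : Idx l) : (m.up : ℂ) = l + m.1 := by
    exact_mod_cast congrArg (Int.cast : ℤ → ℂ) m.natCast_up
  have hdown (m : Idx l) : (m.down : ℂ) = l - m.1 := by
    exact_mod_cast congrArg (Int.cast : ℤ → ℂ) m.natCast_down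
  ext m n
  calc (complexLadder l * (complexLadder l)ᵀ) m n
      = ∑ k : Idx l, (if k.up = n.up + 1 then ((√(n.down * (n.up + 1)) : ℝ) : ℂ) else 0) *
          complexLadder l m k := by
        simp only [mul_apply, transpose_apply, complexLadder_apply l n, mul_comm]
    _ = (if m.up + 1 = n.up + 1 then ((√(n.down * (n.up + 1)) : ℝ) : ℂ) else 0) *
          (√(m.down * (m.up + 1)) : ℝ) :=
        sum_mul_complexLadder_transpose l (fun p _ => if p = n.up + 1 then _ else 0) m
    _ = diagonal (fun m : Idx l => ((l : ℂ) - m.1) * (l + m.1 + 1)) m n := by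
        by_cases hmn : m = n
        · rw [hmn, if_pos rfl, ← Complex.ofReal_mul, Real.mul_self_sqrt (by positivity),
            diagonal_apply_eq, ← hup, ← hdown]
          push_cast
          rfl
        · rw [if_neg fun h => hmn (Idx.up_injective (Nat.succ_injective h)), zero_mul,
            diagonal_apply_ne _ hmn]

theorem casimir_eq_smul_one (l : ℕ) :
    complexLadder l * (complexLadder l)ᵀ + weightMatrix l * weightMatrix l + weightMatrix l =
      ((l : ℂ) * (l + 1)) • 1 := by
  rw [complexLadder_mul_transpose, weightMatrix, diagonal_mul_diagonal, diagonal_add, diagonal_add,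
    smul_one_eq_diagonal]
  congr 1
  ext m
  ring

theorem weightMatrix_mul_complexLadder (l : ℕ) : weightMatrix l * complexLadder l =
    complexLadder l * weightMatrix l - complexLadder l := by
  ext m n
  rw [weightMatrix, Matrix.sub_apply, diagonal_mul, mul_diagonal]
  simp only [complexLadder, ladder, map_apply, of_apply]
  split_ifs with h
  · rw [← h]; push_cast; ring
  · simp

theorem weightMatrix_mul_complexLadder_transpose (l : ℕ) : weightMatrix l * (complexLadder l)ᵀ =
    (complexLadder l)ᵀ * weightMatrix l + (complexLadder l)ᵀ := by
  have h := congrArg transpose (weightMatrix_mul_complexLadder l)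
  rw [transpose_sub, transpose_mul, transpose_mul, weightMatrix, diagonal_transpose] at h
  rw [weightMatrix, h, sub_add_cancel]

section Intertwiner

variable {l l' : ℕ} {T : Matrix (Idx l) (Idx l') ℂ}
  (hT : ∀ A, wignerD l A * T = T * wignerD l' A)

include hT

theorem weightMatrix_mul_eq_mul_weightMatrix : weightMatrix l * T = T * weightMatrix l' := by
  have h : generatorZ l * T = T * generatorZ l' :=
    mul_eq_mul_of_exp_smul_mul_eq fun θ => by rw [← wignerD_rotZ, ← wignerD_rotZ, hT]
  rw [generatorZ, generatorZ, Matrix.smul_mul, Matrix.mul_smul] at h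
  exact smul_right_injective _ (neg_ne_zero.2 Complex.I_ne_zero) h

theorem complexLadder_sub_transpose_mul_eq :
    (complexLadder l - (complexLadder l)ᵀ) * T = T * (complexLadder l' - (complexLadder l')ᵀ) := by
  have h : generatorY l * T = T * generatorY l' :=
    mul_eq_mul_of_exp_smul_mul_eq fun θ => by rw [← wignerD_rotY, ← wignerD_rotY, hT]
  rw [generatorY, generatorY, Matrix.smul_mul, Matrix.mul_smul] at h
  exact smul_right_injective _ (one_div_ne_zero two_ne_zero) h

theorem complexLadder_add_transpose_mul_eq :
    (complexLadder l + (complexLadder l)ᵀ) * T = T * (complexLadder l' + (complexLadder l')ᵀ) := by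
  have hcomm (l : ℕ) : complexLadder l + (complexLadder l)ᵀ =
      (complexLadder l - (complexLadder l)ᵀ) * weightMatrix l -
        weightMatrix l * (complexLadder l - (complexLadder l)ᵀ) := by
    rw [Matrix.sub_mul, Matrix.mul_sub, weightMatrix_mul_complexLadder,
      weightMatrix_mul_complexLadder_transpose]
    abel
  have hΛ := weightMatrix_mul_eq_mul_weightMatrix hT
  have hK := complexLadder_sub_transpose_mul_eq hT
  rw [hcomm, hcomm, Matrix.sub_mul (_ * _), Matrix.mul_sub T, Matrix.mul_assoc _ (weightMatrix l),
    hΛ, ← Matrix.mul_assoc, hK, Matrix.mul_assoc (weightMatrix l), hK,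
    ← Matrix.mul_assoc (weightMatrix l), hΛ, Matrix.mul_assoc, Matrix.mul_assoc]

theorem complexLadder_mul_eq_mul_complexLadder : complexLadder l * T = T * complexLadder l' := by
  have h := congrArg₂ (· + ·) (complexLadder_add_transpose_mul_eq hT)
    (complexLadder_sub_transpose_mul_eq hT)
  simp only [Matrix.add_mul, Matrix.sub_mul, Matrix.mul_add, Matrix.mul_sub, add_add_sub_cancel,
    ← two_smul ℂ] at h
  exact smul_right_injective _ two_ne_zero h

theorem complexLadder_transpose_mul_eq_mul_complexLadder_transpose :
    (complexLadder l)ᵀ * T = T * (complexLadder l')ᵀ := by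
  have h := complexLadder_add_transpose_mul_eq hT
  rwa [Matrix.add_mul, Matrix.mul_add, complexLadder_mul_eq_mul_complexLadder hT,
    add_right_inj] at h

/-- The two representations have different Casimir eigenvalues. -/
theorem eq_zero_of_wignerD_mul_eq (hl : l ≠ l') : T = 0 := by
  have hcasimir : ((l : ℂ) * (l + 1)) • T = ((l' : ℂ) * (l' + 1)) • T :=
    calc ((l : ℂ) * (l + 1)) • T
        = (complexLadder l * (complexLadder l)ᵀ + weightMatrix l * weightMatrix l +
            weightMatrix l) * T := by rw [casimir_eq_smul_one, Matrix.smul_mul, Matrix.one_mul]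
      _ = T * (complexLadder l' * (complexLadder l')ᵀ + weightMatrix l' * weightMatrix l' +
            weightMatrix l') := by
          simp only [Matrix.add_mul, Matrix.mul_add, Matrix.mul_assoc,
            weightMatrix_mul_eq_mul_weightMatrix hT,
            complexLadder_transpose_mul_eq_mul_complexLadder_transpose hT]
          simp only [← Matrix.mul_assoc, weightMatrix_mul_eq_mul_weightMatrix hT,
            complexLadder_mul_eq_mul_complexLadder hT]
      _ = ((l' : ℂ) * (l' + 1)) • T := by rw [casimir_eq_smul_one, Matrix.mul_smul, Matrix.mul_one]
  by_contra hT0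
  have h : l * (l + 1) = l' * (l' + 1) := by exact_mod_cast smul_left_injective ℂ hT0 hcasimir
  exact hl ((StrictMono.injective (f := fun l : ℕ => l * (l + 1)) fun a b hab => by
    dsimp only; gcongr) h)

end Intertwiner

theorem exists_eq_smul_one_of_wignerD_mul_eq {l : ℕ} {T : Matrix (Idx l) (Idx l) ℂ}
    (hT : ∀ A, wignerD l A * T = T * wignerD l A) : ∃ c : ℂ, T = c • 1 := by
  have hoff {m n : Idx l} (hmn : m ≠ n) : T m n = 0 := by
    have h := congrFun (congrFun (weightMatrix_mul_eq_mul_weightMatrix hT) m) n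
    rw [weightMatrix, diagonal_mul, mul_diagonal, mul_comm, ← sub_eq_zero, ← mul_sub] at h
    refine (mul_eq_zero.1 h).resolve_right (sub_ne_zero.2 fun hcast => hmn ?_)
    exact Subtype.ext (Int.cast_injective hcast)
  have hT_eq : T = diagonal fun m => T m m := by
    ext m n
    by_cases hmn : m = n
    · rw [hmn, diagonal_apply_eq]
    · rw [hoff hmn, diagonal_apply_ne _ hmn]
  have hstep {m n : Idx l} (hmn : n.up = m.up + 1) : T n n = T m m := by
    have h := congrFun (congrFun (complexLadder_mul_eq_mul_complexLadder hT) m) n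
    rw [hT_eq, diagonal_mul, mul_diagonal, mul_comm] at h
    refine mul_right_cancel₀ ?_ h
    have := m.up_add_down
    have := n.up_add_down
    rw [complexLadder_apply, if_pos hmn, Complex.ofReal_ne_zero, Real.sqrt_ne_zero']
    have : 0 < m.down := by omega
    positivity
  obtain ⟨m₀, hm₀⟩ := Idx.exists_up_eq (Nat.zero_le (2 * l))
  have hconst (p : ℕ) : ∀ m : Idx l, m.up = p → T m m = T m₀ m₀ := by
    induction p with
    | zero => exact fun m hm => by rw [Idx.up_injective (hm.trans hm₀.symm)]
    | succ p ih =>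
      intro m hm
      have := m.up_add_down
      obtain ⟨k, hk⟩ := Idx.exists_up_eq (l := l) (p := p) (by omega)
      rw [hstep (hm.trans (congrArg (· + 1) hk.symm)), ih k hk]
  refine ⟨T m₀ m₀, ?_⟩
  rw [hT_eq, smul_one_eq_diagonal]
  simp only [diagonal_apply_eq, hconst _ _ rfl]

/-! ### Orthogonality -/

theorem card_idx (l : ℕ) : Fintype.card (Idx l) = 2 * l + 1 := by
  rw [Fintype.card_coe, Int.card_Icc]
  omega

theorem wignerL2_coeFn (l : ℕ) (m n : Idx l) :
    wignerL2 l m n =ᵐ[haar] fun A => (wignerRep l A).1 m n :=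
  (memLp_wignerD l m n).coeFn_toLp

theorem aestronglyMeasurable_wignerRep (l : ℕ) (m n : Idx l) :
    AEStronglyMeasurable (fun A => (wignerRep l A).1 m n) haar :=
  (memLp_wignerD l m n).aestronglyMeasurable

theorem inner_wignerL2 (l l' : ℕ) (m n : Idx l) (m' n' : Idx l') :
    inner ℂ (wignerL2 l' m' n') (wignerL2 l m n) =
      ∫ A, (wignerRep l A).1 m n * star ((wignerRep l' A).1 m' n') ∂haar := by
  rw [L2.inner_def]
  refine integral_congr_ae ?_
  filter_upwards [wignerL2_coeFn l m n, wignerL2_coeFn l' m' n'] with A h h'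
  rw [h, h']
  rfl

theorem inner_wignerL2_of_ne {l l' : ℕ} (hl : l ≠ l') (m n : Idx l) (m' n' : Idx l') :
    inner ℂ (wignerL2 l' m' n') (wignerL2 l m n) = 0 := by
  rw [inner_wignerL2]
  exact integral_entry_mul_star_entry_eq_zero (aestronglyMeasurable_wignerRep l)
    (aestronglyMeasurable_wignerRep l') (fun _ hT => eq_zero_of_wignerD_mul_eq hT hl) m n m' n'

theorem inner_wignerL2_same (l : ℕ) (m n m' n' : Idx l) :
    inner ℂ (wignerL2 l m' n') (wignerL2 l m n) =
      if m = m' ∧ n = n' then (2 * l + 1 : ℂ)⁻¹ else 0 := by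
  rw [inner_wignerL2, integral_entry_mul_star_entry_self (aestronglyMeasurable_wignerRep l)
    fun _ => exists_eq_smul_one_of_wignerD_mul_eq, card_idx]
  push_cast
  rfl

theorem norm_wignerL2_sq (l : ℕ) (m n : Idx l) :
    (‖wignerL2 l m n‖ : ℂ) ^ 2 = (2 * l + 1 : ℂ)⁻¹ := by
  refine (inner_self_eq_norm_sq_to_K (𝕜 := ℂ) (wignerL2 l m n)).symm.trans ?_
  rw [inner_wignerL2_same, if_pos ⟨rfl, rfl⟩]

theorem wignerL2_ne_zero (l : ℕ) (m n : Idx l) : wignerL2 l m n ≠ 0 := by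
  rw [← norm_ne_zero_iff, ← Complex.ofReal_ne_zero, ← pow_ne_zero_iff two_ne_zero,
    norm_wignerL2_sq]
  exact inv_ne_zero (by exact_mod_cast Nat.succ_ne_zero (2 * l))

theorem pairwise_inner_wignerL2_eq_zero :
    Pairwise fun i j : (l : ℕ) × (Idx l × Idx l) =>
      inner ℂ (wignerL2 i.1 i.2.1 i.2.2) (wignerL2 j.1 j.2.1 j.2.2) = 0 := by
  rintro ⟨l', m', n'⟩ ⟨l, m, n⟩ hne
  by_cases hl : l = l'
  · subst hl
    refine (inner_wignerL2_same l m n m' n').trans (if_neg ?_)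
    rintro ⟨rfl, rfl⟩
    exact hne rfl
  · exact inner_wignerL2_of_ne hl m n m' n'

/-! ### Powers of the forms `v U w` -/

theorem mem_of_forall_sum_pow_smul_mem {K V : Type*} [Field K] [Infinite K] [AddCommGroup V]
    [Module K V] {W : Submodule K V} {n : ℕ} {v : ℕ → V}
    (h : ∀ t : K, ∑ i ∈ Finset.range n, t ^ i • v i ∈ W) {i : ℕ} (hi : i < n) : v i ∈ W := by
  rw [← Submodule.Quotient.mk_eq_zero W, ← Module.forall_dual_apply_eq_zero_iff K]
  intro φ
  have hp : ∑ j ∈ Finset.range n, Polynomial.monomial j (φ (W.mkQ (v j))) = 0 := by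
    refine Polynomial.funext fun t => ?_
    have ht : φ (W.mkQ (∑ j ∈ Finset.range n, t ^ j • v j)) = 0 := by
      rw [Submodule.mkQ_apply, (Submodule.Quotient.mk_eq_zero W).2 (h t), map_zero]
    simpa only [map_sum, map_smul, smul_eq_mul, Polynomial.eval_finsetSum,
      Polynomial.eval_monomial, Polynomial.eval_zero, mul_comm] using ht
  have hcoeff := congrArg (Polynomial.coeff · i) hp
  simpa only [Polynomial.finsetSum_coeff, Polynomial.coeff_monomial, Finset.sum_ite_eq',
    Finset.mem_range, if_pos hi, Polynomial.coeff_zero, Submodule.mkQ_apply] using hcoeff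

theorem eval_derivative_mem_of_forall_eval_mem {K R : Type*} [Field K] [Infinite K] [CommRing R]
    [Algebra K R] {W : Submodule K R} {p : Polynomial R}
    (h : ∀ t : K, p.eval (algebraMap K R t) ∈ W) : p.derivative.eval 0 ∈ W := by
  rw [← Polynomial.coeff_zero_eq_eval_zero, Polynomial.coeff_derivative, Nat.cast_zero, zero_add,
    zero_add, mul_one]
  refine mem_of_forall_sum_pow_smul_mem (K := K) (n := p.natDegree + 2) (fun t => ?_) (by omega)
  have hp := h t
  rw [Polynomial.eval_eq_sum_range' (n := p.natDegree + 2) (by omega)] at hp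
  simpa only [Algebra.smul_def, map_pow, mul_comm] using hp

theorem adjoin_le_of_mul_span_le {K R : Type*} [CommSemiring K] [Semiring R] [Algebra K R]
    {s : Set R} {N : Submodule K R} (h1 : 1 ∈ N) (hs : N * Submodule.span K s ≤ N) :
    (Algebra.adjoin K s).toSubmodule ≤ N := by
  rw [Algebra.adjoin_eq_span, Submodule.span_le]
  intro x hx
  induction hx using Submonoid.closure_induction_right with
  | one => exact h1
  | mul_right x _ y hy ih => exact hs (Submodule.mul_mem_mul ih (Submodule.subset_span hy))

/-- The function `A ↦ v U w` on `SO(3)`, where `U` is the lift of `A` to `SU(2)`. -/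
def spinForm (v w : Fin 2 → ℂ) : SO3 → ℂ := fun A => (v ᵥ* spinLift A) ⬝ᵥ w

/-- The span of the `k`-th powers of the functions `A ↦ v U w`. -/
def spinFormPowers (k : ℕ) : Submodule ℂ (SO3 → ℂ) :=
  Submodule.span ℂ (Set.range fun p : (Fin 2 → ℂ) × (Fin 2 → ℂ) => spinForm p.1 p.2 ^ k)

theorem spinForm_pow_mem (k : ℕ) (v w : Fin 2 → ℂ) : spinForm v w ^ k ∈ spinFormPowers k :=
  Submodule.subset_span ⟨(v, w), rfl⟩

theorem spinFormPowers_zero : spinFormPowers 0 = 1 := by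
  simp only [spinFormPowers, pow_zero, Set.range_const, Submodule.one_eq_span]

theorem spinForm_add_smul_left (v v' w : Fin 2 → ℂ) (t : ℂ) :
    spinForm (v + t • v') w = spinForm v w + spinForm v' w * algebraMap ℂ (SO3 → ℂ) t := by
  ext A
  simp [spinForm, add_vecMul, smul_vecMul, add_dotProduct, mul_comm]

theorem spinForm_add_smul_right (v w w' : Fin 2 → ℂ) (t : ℂ) :
    spinForm v (w + t • w') = spinForm v w + spinForm v w' * algebraMap ℂ (SO3 → ℂ) t := by
  ext A
  simp [spinForm, dotProduct_add, mul_comm]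

theorem spinForm_mul_spinForm_sub (v v' w w' : Fin 2 → ℂ) :
    spinForm v w * spinForm v' w' - spinForm v' w * spinForm v w' =
      algebraMap ℂ (SO3 → ℂ) ((v 0 * v' 1 - v 1 * v' 0) * (w 0 * w' 1 - w 1 * w' 0)) := by
  ext A
  have hdet := det_spinLift A
  rw [det_fin_two] at hdet
  simp only [spinForm, vecMul, dotProduct, Fin.sum_univ_two, Pi.sub_apply, Pi.mul_apply,
    Pi.algebraMap_apply, Algebra.algebraMap_self, RingHom.id_apply]
  linear_combination ((v 0 * v' 1 - v 1 * v' 0) * (w 0 * w' 1 - w 1 * w' 0)) * hdet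

theorem spinForm_pow_mul_spinForm_mem (k : ℕ) (v v' w : Fin 2 → ℂ) :
    spinForm v w ^ k * spinForm v' w ∈ spinFormPowers (k + 1) := by
  have h : ((k + 1 : ℂ) • (spinForm v w ^ k * spinForm v' w)) ∈ spinFormPowers (k + 1) := by
    have h := eval_derivative_mem_of_forall_eval_mem (K := ℂ) (W := spinFormPowers (k + 1))
      (p := (Polynomial.C (spinForm v w) + Polynomial.X * Polynomial.C (spinForm v' w)) ^ (k + 1))
      fun t => by
        simpa [spinForm_add_smul_left] using spinForm_pow_mem (k + 1) (v + t • v') w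
    simpa [Polynomial.derivative_pow, Algebra.smul_def, mul_assoc] using h
  exact ((spinFormPowers (k + 1)).smul_mem_iff (Nat.cast_add_one_ne_zero k)).1 h

/-- Differentiating in `w` the previous lemma gives one relation between the products with
`(v, w), (v', w')` and with `(v', w), (v, w')`, and `det U = 1` gives another one. -/
theorem spinForm_pow_succ_mul_spinForm_mem (k : ℕ) (v v' w w' : Fin 2 → ℂ) :
    spinForm v w ^ (k + 1) * spinForm v' w' ∈ spinFormPowers (k + 2) ⊔ spinFormPowers k := by
  have hderiv : (k + 1 : ℂ) • (spinForm v w ^ k * spinForm v w' * spinForm v' w) +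
      spinForm v w ^ (k + 1) * spinForm v' w' ∈ spinFormPowers (k + 2) := by
    have h := eval_derivative_mem_of_forall_eval_mem (K := ℂ) (W := spinFormPowers (k + 2))
      (p := (Polynomial.C (spinForm v w) + Polynomial.X * Polynomial.C (spinForm v w')) ^ (k + 1) *
        (Polynomial.C (spinForm v' w) + Polynomial.X * Polynomial.C (spinForm v' w')))
      fun t => by
        simpa [spinForm_add_smul_right] using
          spinForm_pow_mul_spinForm_mem (k + 1) v v' (w + t • w')
    simpa [Polynomial.derivative_pow, Algebra.smul_def, mul_assoc] using h
  set d : ℂ := (v 0 * v' 1 - v 1 * v' 0) * (w 0 * w' 1 - w 1 * w' 0)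
  have hd : (k + 2 : ℂ) • (spinForm v w ^ (k + 1) * spinForm v' w') =
      ((k + 1 : ℂ) • (spinForm v w ^ k * spinForm v w' * spinForm v' w) +
        spinForm v w ^ (k + 1) * spinForm v' w') + ((k + 1) * d) • spinForm v w ^ k := by
    have hexchange := spinForm_mul_spinForm_sub v v' w w'
    simp only [Algebra.smul_def, map_add, map_mul, map_one, map_natCast, map_ofNat]
    linear_combination (k + 1) * spinForm v w ^ k * hexchange
  have hk : (k + 2 : ℂ) ≠ 0 := by exact_mod_cast Nat.succ_ne_zero (k + 1)
  rw [← (spinFormPowers (k + 2) ⊔ spinFormPowers k).smul_mem_iff hk, hd]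
  exact Submodule.add_mem_sup hderiv (Submodule.smul_mem _ _ (spinForm_pow_mem k v w))

theorem spinFormPowers_succ_mul_le (k : ℕ) :
    spinFormPowers (k + 1) * spinFormPowers 1 ≤ spinFormPowers (k + 2) ⊔ spinFormPowers k := by
  rw [spinFormPowers, spinFormPowers, Submodule.span_mul_span, Submodule.span_le]
  rintro _ ⟨_, ⟨p, rfl⟩, _, ⟨q, rfl⟩, rfl⟩
  simpa only [pow_one, SetLike.mem_coe] using spinForm_pow_succ_mul_spinForm_mem k p.1 q.1 p.2 q.2

/-- The span of the even powers of the functions `A ↦ v U w`. -/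
def evenSpinFormPowers : Submodule ℂ (SO3 → ℂ) := ⨆ l, spinFormPowers (2 * l)

theorem spinFormPowers_le_even (l : ℕ) : spinFormPowers (2 * l) ≤ evenSpinFormPowers :=
  le_iSup (fun l => spinFormPowers (2 * l)) l

theorem one_mem_evenSpinFormPowers : 1 ∈ evenSpinFormPowers :=
  spinFormPowers_le_even 0 (by simpa only [pow_zero] using spinForm_pow_mem 0 0 0)

theorem evenSpinFormPowers_mul_le :
    evenSpinFormPowers * (spinFormPowers 1 * spinFormPowers 1) ≤ evenSpinFormPowers := by
  have hodd (l : ℕ) : spinFormPowers (2 * l + 1) * spinFormPowers 1 ≤ evenSpinFormPowers :=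
    (spinFormPowers_succ_mul_le (2 * l)).trans
      (sup_le (spinFormPowers_le_even (l + 1)) (spinFormPowers_le_even l))
  nth_rw 1 [evenSpinFormPowers]
  rw [← mul_assoc, Submodule.iSup_mul, Submodule.iSup_mul]
  refine iSup_le fun l => ?_
  cases l with
  | zero =>
    rw [Nat.mul_zero, spinFormPowers_zero, one_mul]
    exact hodd 0
  | succ l =>
    refine (mul_le_mul_left (spinFormPowers_succ_mul_le (2 * l + 1)) (spinFormPowers 1)).trans ?_
    rw [Submodule.sup_mul]
    exact sup_le (hodd (l + 1)) (hodd l)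

/-! ### Density -/

theorem spinLift_apply_mem (a b : Fin 2) : (fun A => spinLift A a b) ∈ spinFormPowers 1 := by
  have hform : (fun A => spinLift A a b) = spinForm (Pi.single a 1) (Pi.single b 1) := by
    ext A
    simp [spinForm]
  rw [hform, ← pow_one (spinForm _ _)]
  exact spinForm_pow_mem 1 _ _

theorem adjugate_spinLift_apply_mem (a b : Fin 2) :
    (fun A => (spinLift A).adjugate a b) ∈ spinFormPowers 1 := by
  simp only [adjugate_fin_two]
  fin_cases a <;> fin_cases b
  · exact spinLift_apply_mem 1 1
  · exact neg_mem (spinLift_apply_mem 0 1)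
  · exact neg_mem (spinLift_apply_mem 1 0)
  · exact spinLift_apply_mem 0 0

theorem coe_entry_mem_spinFormPowers_mul (i j : Fin 3) :
    (fun A : SO3 => (A.1 i j : ℂ)) ∈ spinFormPowers 1 * spinFormPowers 1 := by
  have hsum : (fun A : SO3 => (A.1 i j : ℂ)) = ∑ p, ∑ q, ∑ r, ∑ s,
      (pauli i p q * pauli j r s / 2) •
        ((fun A => spinLift A q r) * fun A => (spinLift A).adjugate s p) := by
    ext A
    have hA : (A.1 i j : ℂ) = spinRotation (spinLift A) i j := by
      rw [spinRotation_spinLift]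
      rfl
    rw [hA, spinRotation, of_apply]
    simp only [Finset.sum_apply, Pi.smul_apply, Pi.mul_apply, smul_eq_mul]
    simp only [trace, diag_apply, mul_apply, Fin.sum_univ_two]
    ring
  rw [hsum]
  exact Submodule.sum_mem _ fun p _ => Submodule.sum_mem _ fun q _ => Submodule.sum_mem _
    fun r _ => Submodule.sum_mem _ fun s _ => Submodule.smul_mem _ _ <|
      Submodule.mul_mem_mul (spinLift_apply_mem q r) (adjugate_spinLift_apply_mem s p)

theorem adjoin_entries_le_even :
    (Algebra.adjoin ℂ (Set.range fun p : Fin 3 × Fin 3 =>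
      fun A : SO3 => (A.1 p.1 p.2 : ℂ))).toSubmodule ≤ evenSpinFormPowers := by
  refine adjoin_le_of_mul_span_le one_mem_evenSpinFormPowers <|
    (mul_le_mul_right (Submodule.span_le.2 ?_) evenSpinFormPowers).trans evenSpinFormPowers_mul_le
  rintro _ ⟨p, rfl⟩
  exact coe_entry_mem_spinFormPowers_mul p.1 p.2

theorem oscillator_mul_oscillator_mul (p q : ℕ) (a b c d : ℂ) :
    oscillator p a * oscillator q b * (oscillator p c * oscillator q d) =
      (a * c) ^ p * (b * d) ^ q * (p + q).choose p / (p + q).factorial := by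
  have hsq (p : ℕ) (a c : ℂ) : oscillator p a * oscillator p c = (a * c) ^ p / p.factorial := by
    rw [oscillator, oscillator, div_mul_div_comm, ← mul_pow, ← Complex.ofReal_mul,
      Real.mul_self_sqrt (Nat.cast_nonneg _), Complex.ofReal_natCast]
  have hp : (p.factorial : ℂ) ≠ 0 := Nat.cast_ne_zero.2 p.factorial_ne_zero
  have hq : (q.factorial : ℂ) ≠ 0 := Nat.cast_ne_zero.2 q.factorial_ne_zero
  have hpq : ((p + q).factorial : ℂ) ≠ 0 := Nat.cast_ne_zero.2 (p + q).factorial_ne_zero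
  rw [mul_mul_mul_comm, hsq, hsq, Nat.cast_add_choose]
  field_simp

theorem sum_spinMonomial_mul_spinMonomial (l : ℕ) (x w : Fin 2 → ℂ) :
    ∑ n, spinMonomial l x n * spinMonomial l w n = (x ⬝ᵥ w) ^ (2 * l) / (2 * l).factorial := by
  rw [dotProduct, Fin.sum_univ_two, add_pow, Finset.sum_div]
  refine Finset.sum_bij (fun n _ => n.up) (fun n _ => ?_)
    (fun m _ n _ h => Idx.up_injective h) (fun p hp => ?_) fun n _ => ?_
  · exact Finset.mem_range.2 (by have := n.up_add_down; omega)
  · obtain ⟨m, hm⟩ := Idx.exists_up_eq (Nat.lt_succ_iff.1 (Finset.mem_range.1 hp))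
    exact ⟨m, Finset.mem_univ m, hm⟩
  · rw [spinMonomial, spinMonomial, oscillator_mul_oscillator_mul, n.up_add_down,
      ← n.up_add_down, Nat.add_sub_cancel_left]

/-- The span of the entries of all Wigner D-matrices. -/
def wignerSpan : Submodule ℂ (SO3 → ℂ) :=
  Submodule.span ℂ (Set.range fun i : (l : ℕ) × (Idx l × Idx l) =>
    fun A => wignerD i.1 A i.2.1 i.2.2)

theorem spinForm_pow_eq_sum (l : ℕ) (v w : Fin 2 → ℂ) :
    spinForm v w ^ (2 * l) = ∑ n, ∑ m, (((2 * l).factorial : ℂ) * spinMonomial l v m *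
      spinMonomial l w n) • fun A => wignerD l A m n := by
  ext A
  have hfac : ((2 * l).factorial : ℂ) ≠ 0 := Nat.cast_ne_zero.2 (Nat.factorial_ne_zero _)
  have hsum := sum_spinMonomial_mul_spinMonomial l (v ᵥ* spinLift A) w
  rw [eq_div_iff hfac, spinMonomial_vecMul_spinLift] at hsum
  rw [Pi.pow_apply, spinForm, ← hsum]
  simp only [vecMul, dotProduct, Finset.sum_mul, Finset.sum_apply, Pi.smul_apply, smul_eq_mul]
  exact Finset.sum_congr rfl fun n _ => Finset.sum_congr rfl fun m _ => by ring

theorem evenSpinFormPowers_le_wignerSpan : evenSpinFormPowers ≤ wignerSpan := by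
  refine iSup_le fun l => Submodule.span_le.2 ?_
  rintro _ ⟨⟨v, w⟩, rfl⟩
  simp only [spinForm_pow_eq_sum]
  exact Submodule.sum_mem _ fun n _ => Submodule.sum_mem _ fun m _ =>
    Submodule.smul_mem _ _ (Submodule.subset_span ⟨⟨l, m, n⟩, rfl⟩)

theorem exists_toLp_mem_span_wignerL2 {f : SO3 → ℂ} (hf : f ∈ wignerSpan) :
    ∃ h : MemLp f 2 haar, h.toLp ∈ Submodule.span ℂ
      (Set.range fun i : (l : ℕ) × (Idx l × Idx l) => wignerL2 i.1 i.2.1 i.2.2) := by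
  induction hf using Submodule.span_induction with
  | mem f hf =>
    obtain ⟨⟨l, m, n⟩, rfl⟩ := hf
    exact ⟨memLp_wignerD l m n, Submodule.subset_span ⟨⟨l, m, n⟩, rfl⟩⟩
  | zero => exact ⟨MemLp.zero, by rw [MemLp.toLp_zero]; exact Submodule.zero_mem _⟩
  | add f g _ _ hf hg =>
    obtain ⟨hf, hf_mem⟩ := hf
    obtain ⟨hg, hg_mem⟩ := hg
    exact ⟨hf.add hg, by rw [hf.toLp_add hg]; exact Submodule.add_mem _ hf_mem hg_mem⟩
  | smul c f _ hf =>
    obtain ⟨hf, hf_mem⟩ := hf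
    exact ⟨hf.const_smul c, by rw [hf.toLp_const_smul c]; exact Submodule.smul_mem _ c hf_mem⟩

/-- The entry `(i, j)` as a continuous complex function on `SO(3)`. -/
def entryMap (i j : Fin 3) : C(SO3, ℂ) :=
  ⟨fun A => (A.1 i j : ℂ), Complex.continuous_ofReal.comp (continuous_subtype_val.matrix_elem i j)⟩

theorem star_entryMap (i j : Fin 3) : star (entryMap i j) = entryMap i j := by
  ext A
  exact Complex.conj_ofReal _

/-- The complex polynomial functions in the nine matrix entries on `SO(3)`. -/
def entryPolynomials : StarSubalgebra ℂ C(SO3, ℂ) :=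
  StarAlgebra.adjoin ℂ (Set.range fun p : Fin 3 × Fin 3 => entryMap p.1 p.2)

theorem topologicalClosure_entryPolynomials : entryPolynomials.topologicalClosure = ⊤ := by
  refine ContinuousMap.starSubalgebra_topologicalClosure_eq_top_of_separatesPoints _ ?_
  intro A B hAB
  obtain ⟨i, j, hij⟩ : ∃ i j, A.1 i j ≠ B.1 i j := by
    contrapose! hAB
    exact Subtype.ext (Matrix.ext hAB)
  exact ⟨entryMap i j, ⟨entryMap i j, StarAlgebra.subset_adjoin ℂ _ ⟨(i, j), rfl⟩, rfl⟩,
    fun h => hij (Complex.ofReal_injective h)⟩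

theorem coe_mem_wignerSpan {f : C(SO3, ℂ)} (hf : f ∈ entryPolynomials) : ⇑f ∈ wignerSpan := by
  refine evenSpinFormPowers_le_wignerSpan (adjoin_entries_le_even ?_)
  have hstar : star (Set.range fun p : Fin 3 × Fin 3 => entryMap p.1 p.2) =
      Set.range fun p : Fin 3 × Fin 3 => entryMap p.1 p.2 := by
    rw [← Set.image_star, ← Set.range_comp]
    exact congrArg Set.range (funext fun p => star_entryMap p.1 p.2)
  have hadjoin : f ∈ Algebra.adjoin ℂ (Set.range fun p : Fin 3 × Fin 3 => entryMap p.1 p.2) := by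
    have hf' : f ∈ entryPolynomials.toSubalgebra := hf
    rwa [entryPolynomials, StarAlgebra.adjoin_toSubalgebra, hstar, Set.union_self] at hf'
  have hmap : ⇑f ∈ (Algebra.adjoin ℂ (Set.range fun p : Fin 3 × Fin 3 => entryMap p.1 p.2)).map
      (ContinuousMap.coeFnAlgHom ℂ) := ⟨f, hadjoin, rfl⟩
  rwa [AlgHom.map_adjoin, ← Set.range_comp] at hmap

theorem topologicalClosure_span_wignerL2 : (Submodule.span ℂ (Set.range
    fun i : (l : ℕ) × (Idx l × Idx l) => wignerL2 i.1 i.2.1 i.2.2)).topologicalClosure = ⊤ := by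
  have hclosure : entryPolynomials.toSubalgebra.toSubmodule.topologicalClosure = ⊤ :=
    congrArg (fun S : StarSubalgebra ℂ C(SO3, ℂ) => S.toSubalgebra.toSubmodule)
      topologicalClosure_entryPolynomials
  have hdense := (ContinuousMap.toLp_denseRange (p := 2) ℂ haar ℂ
    (by norm_num)).topologicalClosure_map_submodule hclosure
  refine top_le_iff.1 (hdense ▸ Submodule.topologicalClosure_mono ?_)
  rintro _ ⟨f, hf, rfl⟩
  obtain ⟨_, hf_mem⟩ := exists_toLp_mem_span_wignerL2 (coe_mem_wignerSpan hf)
  exact hf_mem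

/-! ### Fourier coefficients and left covariance -/

theorem hasFourierCoeffs_iff {x : L2SO3} {c : CoeffFamily} : HasFourierCoeffs x c ↔
    ∀ l m n, inner ℂ (wignerL2 l m n) x = c l (-m) (-n) / (2 * (l : ℂ) + 1) := by
  rw [HasFourierCoeffs, hasSum_smul_iff_forall_inner_eq pairwise_inner_wignerL2_eq_zero
    (fun i => wignerL2_ne_zero i.1 i.2.1 i.2.2) topologicalClosure_span_wignerL2]
  simp only [Sigma.forall, Prod.forall, Complex.coe_algebraMap, norm_wignerL2_sq,
    div_eq_mul_inv]

instance (l : ℕ) : InvolutiveNeg (Idx l) where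
  neg_neg m := Subtype.ext (neg_neg m.1)

theorem hasFourierCoeffs_iff_eq {x : L2SO3} {c : CoeffFamily} : HasFourierCoeffs x c ↔
    c = fun (l : ℕ) m n => (2 * (l : ℂ) + 1) * inner ℂ (wignerL2 l (-m) (-n)) x := by
  have hl (l : ℕ) : 2 * (l : ℂ) + 1 ≠ 0 := by exact_mod_cast Nat.succ_ne_zero (2 * l)
  rw [hasFourierCoeffs_iff]
  constructor
  · intro h
    ext l m n
    rw [h, neg_neg, neg_neg, mul_div_cancel₀ _ (hl l)]
  · rintro rfl l m n
    simp only [neg_neg, mul_div_cancel_left₀ _ (hl l)]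

theorem existsUnique_hasFourierCoeffs (x : L2SO3) : ∃! c, HasFourierCoeffs x c := by
  simp only [hasFourierCoeffs_iff_eq, existsUnique_eq]

theorem inner_leftAction_leftAction (A : SO3) (x y : L2SO3) :
    inner ℂ (leftAction A x) (leftAction A y) = inner ℂ x y :=
  (Lp.compMeasurePreservingₗᵢ ℂ _ (measurePreserving_mul_left haar A⁻¹)).inner_map_map x y

theorem leftAction_leftAction_inv (A : SO3) (y : L2SO3) :
    leftAction A (leftAction A⁻¹ y) = y := by
  rw [leftAction, leftAction, ← Lp.compMeasurePreserving_comp_apply]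
  convert Lp.compMeasurePreserving_id_apply y using 3
  ext1 B
  simp

theorem inner_leftAction_left (A : SO3) (x y : L2SO3) :
    inner ℂ (leftAction A x) y = inner ℂ x (leftAction A⁻¹ y) := by
  rw [← inner_leftAction_leftAction A x, leftAction_leftAction_inv]

theorem norm_leftAction (A : SO3) (y : L2SO3) : ‖leftAction A y‖ = ‖y‖ :=
  Lp.norm_compMeasurePreserving y (measurePreserving_mul_left haar A⁻¹)

theorem continuous_leftAction (y : L2SO3) : Continuous fun A => leftAction A y := by
  let translation : C(SO3, C(SO3, SO3)) :=
    ContinuousMap.curry ⟨fun p : SO3 × SO3 => p.1⁻¹ * p.2, by fun_prop⟩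
  exact (continuous_const (y := y)).compMeasurePreservingLp translation.continuous
    (fun A => measurePreserving_mul_left haar A⁻¹) ENNReal.ofNat_ne_top

theorem continuous_leftCovariance (x ψ : L2SO3) : Continuous (leftCovariance x ψ) :=
  (continuous_leftAction ψ).inner continuous_const

theorem norm_leftCovariance_le (x ψ : L2SO3) (A : SO3) : ‖leftCovariance x ψ A‖ ≤ ‖ψ‖ * ‖x‖ := by
  rw [← norm_leftAction A ψ]
  exact norm_inner_le_norm _ _

theorem memLp_leftCovariance (x ψ : L2SO3) : MemLp (leftCovariance x ψ) 2 haar :=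
  MemLp.of_bound (continuous_leftCovariance x ψ).aestronglyMeasurable _
    (Filter.Eventually.of_forall (norm_leftCovariance_le x ψ))

/-- The left covariance with `ψ` as a continuous linear map into the continuous functions. -/
def leftCovarianceCLM (ψ : L2SO3) : L2SO3 →L[ℂ] C(SO3, ℂ) :=
  LinearMap.mkContinuous
    { toFun := fun x => ⟨leftCovariance x ψ, continuous_leftCovariance x ψ⟩
      map_add' := fun x y => ContinuousMap.ext fun A => inner_add_right (leftAction A ψ) x y
      map_smul' := fun c x => ContinuousMap.ext fun A => inner_smul_right (leftAction A ψ) x c }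
    ‖ψ‖ fun x => (ContinuousMap.norm_le _ (by positivity)).2 (norm_leftCovariance_le x ψ)

theorem toLp_leftCovarianceCLM (x ψ : L2SO3) :
    ContinuousMap.toLp 2 haar ℂ (leftCovarianceCLM ψ x) = (memLp_leftCovariance x ψ).toLp :=
  Lp.ext ((ContinuousMap.coeFn_toLp haar _).trans (memLp_leftCovariance x ψ).coeFn_toLp.symm)

theorem sum_smul_wignerL2_coeFn {ι : Type*} [Fintype ι] (l : ℕ) (c : ι → ℂ) (m n : ι → Idx l) :
    (∑ i, c i • wignerL2 l (m i) (n i) : L2SO3) =ᵐ[haar]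
      fun A => ∑ i, c i * wignerD l A (m i) (n i) := by
  have hterm : ∀ᵐ A ∂haar, ∀ i, (c i • wignerL2 l (m i) (n i) : L2SO3) A =
      c i * wignerD l A (m i) (n i) := by
    refine ae_all_iff.2 fun i => ?_
    filter_upwards [Lp.coeFn_smul (c i) (wignerL2 l (m i) (n i)), wignerL2_coeFn l (m i) (n i)]
      with A hsmul hA
    rw [hsmul, Pi.smul_apply, hA, smul_eq_mul]
    rfl
  filter_upwards [hterm, Lp.coeFn_finsetSum Finset.univ
    fun i => (c i • wignerL2 l (m i) (n i) : L2SO3)] with A hA hsum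
  rw [hsum, Finset.sum_apply]
  exact Finset.sum_congr rfl fun i _ => hA i

theorem leftAction_inv_wignerL2 (l : ℕ) (m n : Idx l) (A : SO3) :
    leftAction A⁻¹ (wignerL2 l m n) = ∑ s, wignerD l A m s • wignerL2 l s n := by
  refine Lp.ext ?_
  filter_upwards [((memLp_wignerD l m n).comp_measurePreserving
    (measurePreserving_mul_left haar A⁻¹⁻¹)).coeFn_toLp,
    sum_smul_wignerL2_coeFn l (wignerD l A m) id fun _ => n] with B hleft hsum
  refine hleft.trans (Eq.trans ?_ hsum.symm)
  rw [Function.comp_apply, inv_inv, wignerD_mul, mul_apply]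
  rfl

theorem leftCovariance_wignerL2 (ψ : L2SO3) (l : ℕ) (m n : Idx l) (A : SO3) :
    leftCovariance (wignerL2 l m n) ψ A =
      ∑ s, inner ℂ ψ (wignerL2 l s n) * wignerD l A m s := by
  simp only [leftCovariance, inner_leftAction_left, leftAction_inv_wignerL2, inner_sum,
    inner_smul_right, mul_comm]

theorem toLp_leftCovariance_wignerL2 (ψ : L2SO3) (l : ℕ) (m n : Idx l) :
    (memLp_leftCovariance (wignerL2 l m n) ψ).toLp =
      ∑ s, inner ℂ ψ (wignerL2 l s n) • wignerL2 l m s := by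
  refine Lp.ext ?_
  filter_upwards [(memLp_leftCovariance (wignerL2 l m n) ψ).coeFn_toLp,
    sum_smul_wignerL2_coeFn l (fun s => inner ℂ ψ (wignerL2 l s n)) (fun _ => m) id]
    with A hleft hsum
  refine hleft.trans (Eq.trans ?_ hsum.symm)
  exact leftCovariance_wignerL2 ψ l m n A

theorem inner_wignerL2_toLp_leftCovariance_wignerL2 (ψ : L2SO3) {l l' : ℕ} (p q : Idx l)
    (m n : Idx l') :
    inner ℂ (wignerL2 l p q) (memLp_leftCovariance (wignerL2 l' m n) ψ).toLp =
      ∑ s, inner ℂ ψ (wignerL2 l q s) * inner ℂ (wignerL2 l p s) (wignerL2 l' m n) := by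
  rw [toLp_leftCovariance_wignerL2, inner_sum]
  simp only [inner_smul_right]
  by_cases hl : l' = l
  · subst hl
    by_cases hm : m = p <;> simp [inner_wignerL2_same, hm]
  · simp only [inner_wignerL2_of_ne hl, mul_zero, Finset.sum_const_zero]

/-- Both sides are continuous and linear in `x`, so it suffices to let `x` be an entry of a Wigner
D-matrix. -/
theorem inner_wignerL2_toLp_leftCovariance (x ψ : L2SO3) (l : ℕ) (p q : Idx l) :
    inner ℂ (wignerL2 l p q) (memLp_leftCovariance x ψ).toLp =
      ∑ s, inner ℂ ψ (wignerL2 l q s) * inner ℂ (wignerL2 l p s) x := by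
  have hCLM : innerSL ℂ (wignerL2 l p q) ∘L ContinuousMap.toLp 2 haar ℂ ∘L leftCovarianceCLM ψ =
      ∑ s, inner ℂ ψ (wignerL2 l q s) • innerSL ℂ (wignerL2 l p s) := by
    refine ContinuousLinearMap.ext_on
      (Submodule.dense_iff_topologicalClosure_eq_top.2 topologicalClosure_span_wignerL2) ?_
    rintro _ ⟨⟨l', m, n⟩, rfl⟩
    simpa [toLp_leftCovarianceCLM] using inner_wignerL2_toLp_leftCovariance_wignerL2 ψ p q m n
  simpa [toLp_leftCovarianceCLM] using congrArg (fun T : L2SO3 →L[ℂ] ℂ => T x) hCLM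

theorem hasFourierCoeffs_toLp_leftCovariance {x ψ : L2SO3} {c d : CoeffFamily}
    (hx : HasFourierCoeffs x c) (hψ : HasFourierCoeffs ψ d) :
    HasFourierCoeffs (memLp_leftCovariance x ψ).toLp (fun l m n => 1 / (2 * (l : ℂ) + 1) *
      ∑ s : Idx l, c l m s * (starRingEnd ℂ) (d l n s)) := by
  rw [hasFourierCoeffs_iff] at *
  intro l m n
  rw [inner_wignerL2_toLp_leftCovariance, Finset.mul_sum, Finset.sum_div]
  refine Fintype.sum_equiv (Equiv.neg (Idx l)) _ _ fun s => ?_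
  rw [← inner_conj_symm, hx, hψ, map_div₀, Equiv.neg_apply]
  simp only [map_add, map_mul, map_one, Complex.conj_natCast, Complex.conj_ofNat]
  ring

end SO3Fourier

end

open SO3Fourier MeasureTheory in
theorem mainTheorem2 :
    (∀ x : L2SO3, ∃! c : CoeffFamily, HasFourierCoeffs x c) ∧
      ∀ (x ψ : L2SO3) (xhat ψhat : CoeffFamily),
        HasFourierCoeffs x xhat → HasFourierCoeffs ψ ψhat →
          ∃ h : MemLp (leftCovariance x ψ) 2 haar,
            HasFourierCoeffs h.toLp
              (fun l m n => 1 / (2 * (l : ℂ) + 1) *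
                ∑ s : Idx l, xhat l m s * (starRingEnd ℂ) (ψhat l n s)) :=
  ⟨existsUnique_hasFourierCoeffs, fun x ψ _ _ hx hψ =>
    ⟨memLp_leftCovariance x ψ, hasFourierCoeffs_toLp_leftCovariance hx hψ⟩⟩
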